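/- **Setting.** Let $X$ be a finite set, $d,n\ge 1$ integers, $\Omega=X^d$, and write $\tau_{i,\alpha}x$ for the configuration obtained from $x\in\Omega$ by replacing $x_i$ with $\alpha\in X$. Let $r_{i,\alpha}:\Omega\to[0,\infty)$ ($1\le i\le d$, $\alpha\in X$) be rates, $(\mathcal L f)(x)=\sum_{i=1}^d\sum_{\alpha\in X} r_{i,\alpha}(x)\,(f(\tau_{i,\alpha}x)-f(x))$ and $\mathcal P_t=e^{t\mathcal L}$. Let $\rho$ be an everywhere positive probability density on $\Omega$ satisfying detailed balance, $\rho(x)r_{i,\alpha}(x)=\rho(\tau_{i,\alpha}x)\,r_{i,x_i}(\tau_{i,\alpha}x)$, and put $\langle f,g\rangle=\sum_x f(x)g(x)\rho(x)$. Assume: 1. (Finite range) There is an integer $\kappa>0$ such that $r_{i,\alpha}(x)$ depends only on the coordinates $x_{j}$ with $|i-j|\le\kappa$. 2. (Spectral gap) $|\Omega|>1$, and $-\mathcal L$ has eigenpairs $(\lambda_k,w_k)_{0\le k<|\Omega|}$, orthonormal for $\langle\cdot,\cdot\rangle$, with $w_0\equiv1$ and $0=\lambda_0<\lambda_1\le\lambda_2\le\cdots$;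 write $\lambda=\lambda_1$. 3. (Bounded two-cluster basis) Let $\varphi^i_b:X\to\mathbb R$ ($1\le i\le d$, $1\le b\le n$) be functions (for instance orthonormal families with $\varphi^i_1$ constant; neither property is needed). For $j=((s_1(j),b_1(j)),(s_2(j),b_2(j)))\in([d]\times[n])^2$ let $\psi_j(x)=\varphi^{s_1(j)}_{b_1(j)}(x_{s_1(j)})\,\varphi^{s_2(j)}_{b_2(j)}(x_{s_2(j)})$. For some $\mathcal C_0>0$ and all $j$, $\langle\psi_j,\psi_j\rangle^{1/2}\le\mathcal C_0$ and $\sum_{i=1}^d\mathrm{Osc}_i(\psi_j)\le\mathcal C_0$, where $\mathrm{Osc}_i(f)$ is the largest $|f(x)-f(y)|$ over $x,y$ that differ at most at site $i$. For $t\ge0$ let $M=M^t$ be the $(dn)^2\times(dn)^2$ matrix $M(i,j)=\langle\psi_i,\mathcal P_t\psi_j\rangle$; let $\|\cdot\|_2$ be the spectral norm of a matrix or the Euclidean norm of a vector, and $\sigma_1(M)\ge\sigma_2(M)\ge\cdots$ the singular values (with $\sigma_k(M)=0$ for $k>(dn)^2$). Put $$r_{\max}=\max_{i,\alpha,x} r_{i,\alpha}(x),\quad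 \bar r=\max_x\sum_{i,\alpha} r_{i,\alpha}(x),\quad v=2(e-1)(2\kappa+1)\kappa\,(|X|r_{\max}+\bar r),$$ $$\mathcal C_1=|X|\,r_{\max}\max\Big(\frac1\lambda,\frac{\kappa}{v}\Big),\qquad \mathcal C_2=\mathcal C_1\max\{\mathcal C_0^2,\mathcal C_0^3\}.$$ Let $\xi(i,j)=\min_{a,b\in\{1,2\}}|s_a(i)-s_b(j)|$. For real $\delta>0$, say that $i$ is in the $\delta$-band of $j$ if $\min(\xi(i,j),|s_1(i)-s_2(i)|)\le\delta$. **Theorem.** There is an absolute constant $K$ such that in every such setting, for every real $\delta>0$ and every integer $1\le r\le(dn)^2$, there are a set $J=\{j_1,\dots,j_r\}$ of $r$ distinct column indices, a matrix $U\in\mathbb R^{r\times r}$ and a matrix $C\in\mathbb R^{(dn)^2\times r}$ with the following properties. (a) For each $l$, the $l$-th column of $C$ is the vectorization of $S_l+W_l$, where $W_l$ is a $dn\times dn$ matrix of rank at most one, and $S_l$ is a sparse $dn\times dn$ matrix: $S_l(i)=M(i,j_l)-W_l(i)$ if $i$ is in the $\delta$-band of $j_l$ and $S_l(i)=0$ otherwise,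 and $S_l$ has at most $K\,n^2d\lceil\delta\rceil$ nonzero entries. Moreover $C$ approximates $M(:,J)$: $$\|M(:,j_l)-C(:,l)\|_2\le 2\,\mathcal C_2\,nd\,\sqrt{d\max(d-\delta,0)}\;e^{-\frac{\lambda\delta}{v+\lambda\kappa}}.$$ (b) If $\sigma_{r+1}(M)>0$ and $$\delta\ \ge\ \frac{v+\lambda\kappa}{\lambda}\,\log\!\left(\frac{2\,\mathcal C_2\,d^2n^2\sqrt r}{\sigma_1(M)}\right),$$ then $$\frac{\|M-CUC^{T}\|_2}{\|M\|_2}\ \le\ \frac{\mathcal C_0^2(dn)^2(1+4\sqrt r\,dn)\,e^{-\lambda_r t}}{\sigma_1(M)}+\frac{6\,\mathcal C_2\,(dn)^2\,r\,\sqrt{d\max(d-\delta,0)}\;e^{-\frac{\lambda\delta}{v+\lambda\kappa}}}{\sigma_{r+1}(M)}.$$ -/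

import Mathlib

/-! ### The many-body Markov process on `Ω = X ^ d` -/

/-- Configurations `x = (x_1, …, x_d)` on `d` sites with single-site state space `X`. -/
abbrev Config (X : Type*) (d : ℕ) := Fin d → X

noncomputable section

/-- The generator `(𝓛 f)(x) = ∑ i, ∑ α, r_{i,α}(x) (f (τ_{i,α} x) - f x)`, where
`τ_{i,α} x = Function.update x i α` replaces the state at site `i` by `α`. -/
def generator {X : Type*} [Fintype X] {d : ℕ} (rate : Fin d → X → Config X d → ℝ) :
    (Config X d → ℝ) →ₗ[ℝ] (Config X d → ℝ) where
  toFun f x := ∑ i, ∑ α, rate i α x * (f (Function.update x i α) - f x)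
  map_add' f g := by
    funext x
    simp only [Pi.add_apply, ← Finset.sum_add_distrib]
    exact Finset.sum_congr rfl fun i _ => Finset.sum_congr rfl fun α _ => by ring
  map_smul' c f := by
    funext x
    simp only [Pi.smul_apply, smul_eq_mul, RingHom.id_apply, Finset.mul_sum]
    exact Finset.sum_congr rfl fun i _ => Finset.sum_congr rfl fun α _ => by ring

/-- The transition operator `𝓟_t = exp (t 𝓛)`. -/
def transitionOp {X : Type*} [Fintype X] [DecidableEq X] {d : ℕ}
    (rate : Fin d → X → Config X d → ℝ) (t : ℝ) :
    (Config X d → ℝ) →ₗ[ℝ] (Config X d → ℝ) :=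
  Matrix.toLin' (NormedSpace.exp (t • LinearMap.toMatrix' (generator rate)))

/-- The inner product `⟨f, g⟩_ρ = ∑ x, f x g x ρ x`. -/
def innerRho {X : Type*} [Fintype X] {d : ℕ} (ρ : Config X d → ℝ) (f g : Config X d → ℝ) : ℝ :=
  ∑ x, f x * g x * ρ x

/-- The norm of `L²_ρ`. -/
def normRho {X : Type*} [Fintype X] {d : ℕ} (ρ : Config X d → ℝ) (f : Config X d → ℝ) : ℝ :=
  Real.sqrt (innerRho ρ f f)

/-- `rate` are the rates of a reversible process with (everywhere positive) equilibrium
density `ρ`: the rates are non-negative, `ρ` is a probability density and detailed balance holds. -/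
structure IsReversible {X : Type*} [Fintype X] {d : ℕ} (rate : Fin d → X → Config X d → ℝ)
    (ρ : Config X d → ℝ) : Prop where
  rate_nonneg : ∀ i α x, 0 ≤ rate i α x
  density_pos : ∀ x, 0 < ρ x
  density_sum : ∑ x, ρ x = 1
  detailed_balance : ∀ i α x,
    ρ x * rate i α x = ρ (Function.update x i α) * rate i (x i) (Function.update x i α)

/-- The distance `|i - j|` between two sites. -/
def siteDist {d : ℕ} (i j : Fin d) : ℕ := ((i : ℤ) - (j : ℤ)).natAbs

/-- Interaction range `κ`: the rates at site `i` only depend on the sites within distance `κ`. -/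
def FiniteRange {X : Type*} {d : ℕ} (rate : Fin d → X → Config X d → ℝ) (κ : ℕ) : Prop :=
  ∀ i α x y, (∀ j, siteDist i j ≤ κ → x j = y j) → rate i α x = rate i α y

/-- `(lam k, w k)`, `k < |Ω|`, are the eigenpairs of `-𝓛`, orthonormal in `L²_ρ` and listed in
non-decreasing order, with `w 0 = 1` and `0 = lam 0 < lam 1`.
(Values at `k ≥ |Ω|` are irrelevant.) -/
structure SpectralGap {X : Type*} [Fintype X] {d : ℕ} (rate : Fin d → X → Config X d → ℝ)
    (ρ : Config X d → ℝ) (lam : ℕ → ℝ) (w : ℕ → Config X d → ℝ) : Prop where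
  one_lt_card : 1 < Fintype.card (Config X d)
  eigen : ∀ k < Fintype.card (Config X d), -(generator rate (w k)) = lam k • w k
  orthonormal : ∀ k < Fintype.card (Config X d), ∀ l < Fintype.card (Config X d),
    innerRho ρ (w k) (w l) = if k = l then 1 else 0
  w_zero : ∀ x, w 0 x = 1
  lam_zero : lam 0 = 0
  gap : 0 < lam 1
  mono : ∀ k l, k ≤ l → l < Fintype.card (Config X d) → lam k ≤ lam l

/-- `r_max`, the largest single rate. -/
def rMax {X : Type*} {d : ℕ} (rate : Fin d → X → Config X d → ℝ) : ℝ :=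
  ⨆ p : Fin d × X × Config X d, rate p.1 p.2.1 p.2.2

/-- `r̄`, the largest total rate. -/
def rBar {X : Type*} [Fintype X] {d : ℕ} (rate : Fin d → X → Config X d → ℝ) : ℝ :=
  ⨆ x : Config X d, ∑ i, ∑ α, rate i α x

/-- The velocity `v = 2 (e - 1) (2κ + 1) κ (|X| r_max + r̄)`. -/
def velocity {X : Type*} [Fintype X] {d : ℕ} (rate : Fin d → X → Config X d → ℝ) (κ : ℕ) : ℝ :=
  2 * (Real.exp 1 - 1) * (2 * κ + 1) * κ * (Fintype.card X * rMax rate + rBar rate)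

/-- `𝒞₁ = |X| r_max max (1 / lam₁) (κ / v)`, with `lam₁` the spectral gap. -/
def constC₁ {X : Type*} [Fintype X] {d : ℕ} (rate : Fin d → X → Config X d → ℝ) (κ : ℕ)
    (lam₁ : ℝ) : ℝ :=
  Fintype.card X * rMax rate * max (1 / lam₁) (κ / velocity rate κ)

/-- `𝒞₂ = 𝒞₁ max (𝒞₀²) (𝒞₀³)`. -/
def constC₂ {X : Type*} [Fintype X] {d : ℕ} (rate : Fin d → X → Config X d → ℝ) (κ : ℕ)
    (lam₁ C₀ : ℝ) : ℝ :=
  constC₁ rate κ lam₁ * max (C₀ ^ 2) (C₀ ^ 3)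

/-- The oscillation of `f` at site `i`. -/
def osc {X : Type*} {d : ℕ} (i : Fin d) (f : Config X d → ℝ) : ℝ :=
  ⨆ p : Config X d × X × X,
    |f (Function.update p.1 i p.2.1) - f (Function.update p.1 i p.2.2)|

/-- The oscillation seminorm. -/
def oscNorm {X : Type*} {d : ℕ} (f : Config X d → ℝ) : ℝ := ∑ i, osc i f

/-! ### Two-cluster functions and the transition moment matrix -/

/-- Indices of univariate functions: `(k, b)` is the `b`-th function at site `k`. -/
abbrev SiteIdx (d n : ℕ) := Fin d × Fin n

/-- The `(dn)²` indices `j = ((s₁, b₁), (s₂, b₂))` of the two-cluster functions. A vector indexed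
by them is the vectorization of a `dn × dn` matrix indexed by `SiteIdx d n`. -/
abbrev ClusterIdx (d n : ℕ) := SiteIdx d n × SiteIdx d n

/-- The two-cluster function `ψ_j(x) = φ^{s₁}_{b₁}(x_{s₁}) φ^{s₂}_{b₂}(x_{s₂})`. -/
def clusterFun {X : Type*} {d n : ℕ} (φ : Fin d → Fin n → X → ℝ) (j : ClusterIdx d n) :
    Config X d → ℝ :=
  fun x => φ j.1.1 j.1.2 (x j.1.1) * φ j.2.1 j.2.2 (x j.2.1)

/-- Boundedness of the two-cluster functions by `C₀`. -/
def ClusterBound {X : Type*} [Fintype X] {d n : ℕ} (ρ : Config X d → ℝ)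
    (φ : Fin d → Fin n → X → ℝ) (C₀ : ℝ) : Prop :=
  ∀ j : ClusterIdx d n,
    normRho ρ (clusterFun φ j) ≤ C₀ ∧ oscNorm (clusterFun φ j) ≤ C₀

/-- The transition moment matrix `M^t(i, j) = ⟨ψ_i, 𝓟_t ψ_j⟩_ρ`. -/
def momentMatrix {X : Type*} [Fintype X] [DecidableEq X] {d n : ℕ}
    (rate : Fin d → X → Config X d → ℝ) (ρ : Config X d → ℝ) (φ : Fin d → Fin n → X → ℝ)
    (t : ℝ) : Matrix (ClusterIdx d n) (ClusterIdx d n) ℝ :=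
  Matrix.of fun i j => innerRho ρ (clusterFun φ i) (transitionOp rate t (clusterFun φ j))

/-- The distance `ξ(i, j)` between the sites of two cluster indices. -/
def clusterDist {d n : ℕ} (i j : ClusterIdx d n) : ℕ :=
  min (min (siteDist i.1.1 j.1.1) (siteDist i.2.1 j.2.1))
    (min (siteDist i.1.1 j.2.1) (siteDist i.2.1 j.1.1))

/-- `i` lies in the band of width `δ` around `j`: `min (ξ(i, j)) |s₁(i) - s₂(i)| ≤ δ`. -/
def InBand {d n : ℕ} (δ : ℝ) (j i : ClusterIdx d n) : Prop :=
  (min (clusterDist i j) (siteDist i.1.1 i.2.1) : ℝ) ≤ δ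

/-- The spectral norm of a square real matrix. -/
def specNorm {ι : Type*} [Fintype ι] [DecidableEq ι] (A : Matrix ι ι ℝ) : ℝ :=
  ‖Matrix.toEuclideanCLM (n := ι) (𝕜 := ℝ) A‖

/-- The `k`-th largest singular value `σ_k(A)`, `k = 1, 2, …`, counted with multiplicity
(Mathlib counts from `0`). -/
def sigma {ι : Type*} [Fintype ι] [DecidableEq ι] (k : ℕ) (A : Matrix ι ι ℝ) : ℝ :=
  (Matrix.toEuclideanLin A).singularValues (k - 1)

/-- The decay factor `exp (-lam₁ δ / (v + lam₁ κ))`. -/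
def decayFactor {X : Type*} [Fintype X] {d : ℕ} (rate : Fin d → X → Config X d → ℝ) (κ : ℕ)
    (lam₁ δ : ℝ) : ℝ :=
  Real.exp (-(lam₁ * δ / (velocity rate κ + lam₁ * κ)))

end

/-! Two independent mechanisms are combined: a low-rank one in the spectrum and a local one in
space.

Spectrum. In the eigenbasis, `M i j` is the sum over `k` of `exp (-lam k * t)` times the `k`-th
coefficients of `ψ_i` and `ψ_j`; the modes `k ≥ r` contribute at most `C₀ ^ 2 * exp (-lam r * t)` to
each entry. Attach to every index `i` its vector of coefficients on the first `r` modes. A choice of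
`r` of these vectors of maximal volume expresses all the others with coefficients in `[-1, 1]`, and
the same coefficients express all columns of `M` through the chosen ones, up to the fast modes
(`ClusterBound.exists_column_selection`).

Space. Outside the band, `ψ_i` is far from `ψ_j` and its own two sites are far apart. Hence `M i j`
is close to the product of the means of `ψ_j`, `φ_p` and `φ_q`, where `i = (p, q)`: for fixed `j`
this is a rank-one matrix in `p, q`. Both decorrelations come from
`SpectralGap.abs_cov_le_of_lightcone`, at time `t` for the pair `ψ_i, ψ_j` and at time `0` for the
pair `φ_p, φ_q`. Late covariances are killed by the gap. At early times the derivative of `⟨P_s f,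
g⟩` is a Dirichlet form, which only sees the oscillation of `P_s f` on the sites of `g`, and the
Lieb–Robinson bound `osc_transitionOp_le` keeps that small. Balancing the two regimes gives the rate
`λ / (v + λ κ)`.

Combination. If `P` is the orthogonal projection onto the column space of `C`, then `P M P` has the
form `C U Cᵀ`, and since `M` is symmetric its error is at most twice that of any one-sided
approximation `C T` (`exists_symmetric_cross_approx`). With `T` the matrix of bounded coefficients,
that error splits into the fast modes and the column errors. -/

/-! ### The weighted inner product -/

section InnerRho

variable {X : Type*} [Fintype X] {d : ℕ} (ρ : Config X d → ℝ)

lemma innerRho_comm (f g : Config X d → ℝ) : innerRho ρ f g = innerRho ρ g f :=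
  Finset.sum_congr rfl fun x _ => by ring

lemma innerRho_sum_left {ι : Type*} (s : Finset ι) (c : ι → ℝ) (F : ι → Config X d → ℝ)
    (g : Config X d → ℝ) :
    innerRho ρ (fun x => ∑ k ∈ s, c k * F k x) g = ∑ k ∈ s, c k * innerRho ρ (F k) g := by
  simp only [innerRho, Finset.sum_mul, Finset.mul_sum]
  rw [Finset.sum_comm]
  exact Finset.sum_congr rfl fun k _ => Finset.sum_congr rfl fun x _ => by ring

lemma normRho_nonneg (f : Config X d → ℝ) : 0 ≤ normRho ρ f := Real.sqrt_nonneg _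

variable {ρ}

lemma innerRho_self_nonneg (hρ : ∀ x, 0 < ρ x) (f : Config X d → ℝ) : 0 ≤ innerRho ρ f f :=
  Finset.sum_nonneg fun x _ => mul_nonneg (mul_self_nonneg _) (hρ x).le

lemma normRho_sq (hρ : ∀ x, 0 < ρ x) (f : Config X d → ℝ) :
    normRho ρ f ^ 2 = innerRho ρ f f :=
  Real.sq_sqrt (innerRho_self_nonneg hρ f)

lemma abs_innerRho_le (hρ : ∀ x, 0 < ρ x) (f g : Config X d → ℝ) :
    |innerRho ρ f g| ≤ normRho ρ f * normRho ρ g := by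
  refine abs_le_of_sq_le_sq ?_ (mul_nonneg (normRho_nonneg ρ f) (normRho_nonneg ρ g))
  rw [mul_pow, normRho_sq hρ, normRho_sq hρ]
  have := Finset.sum_mul_sq_le_sq_mul_sq Finset.univ (fun x => f x * √(ρ x))
    (fun x => g x * √(ρ x))
  have e : ∀ x, √(ρ x) * √(ρ x) = ρ x := fun x => Real.mul_self_sqrt (hρ x).le
  have h1 : ∀ a b : Config X d → ℝ,
      ∑ x, (a x * √(ρ x)) * (b x * √(ρ x)) = innerRho ρ a b := fun a b =>
    Finset.sum_congr rfl fun x _ => by rw [mul_mul_mul_comm, e]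
  simpa only [pow_two (_ * √_), h1] using this

end InnerRho

/-! ### Spectral expansion of the generator and the semigroup -/

lemma Matrix.exp_mulVec_of_mulVec_eq_smul {ι : Type*} [Fintype ι] [DecidableEq ι]
    (A : Matrix ι ι ℝ) (v : ι → ℝ) (c : ℝ) (h : A.mulVec v = c • v) :
    (NormedSpace.exp A).mulVec v = Real.exp c • v := by
  -- Any matrix norm would do; it only serves the convergence of the exponential series.
  let _ : SeminormedRing (Matrix ι ι ℝ) := Matrix.linftyOpSemiNormedRing
  let _ : NormedRing (Matrix ι ι ℝ) := Matrix.linftyOpNormedRing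
  let _ : NormedAlgebra ℝ (Matrix ι ι ℝ) := Matrix.linftyOpNormedAlgebra
  have hpow : ∀ n : ℕ, (A ^ n).mulVec v = c ^ n • v := by
    intro n
    induction n with
    | zero => simp
    | succ n ih => rw [pow_succ, ← Matrix.mulVec_mulVec, h, Matrix.mulVec_smul, ih, smul_smul,
        pow_succ, mul_comm]
  have h1 := NormedSpace.exp_series_hasSum_exp' (𝕂 := ℝ) A
  have h2 := NormedSpace.exp_series_hasSum_exp' (𝕂 := ℝ) c
  rw [← Real.exp_eq_exp_ℝ] at h2
  let T : Matrix ι ι ℝ →+ (ι → ℝ) :=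
    { toFun := fun B => B.mulVec v
      map_zero' := Matrix.zero_mulVec v
      map_add' := fun B C => Matrix.add_mulVec B C v }
  have hT : Continuous T := Continuous.matrix_mulVec continuous_id continuous_const
  have h3 := h1.map T hT
  refine h3.unique ?_
  have h4 := h2.smul_const v
  convert h4 using 2 with n
  simp [T, Matrix.smul_mulVec, hpow, smul_smul]

section Spectral

variable {X : Type*} [Fintype X] [DecidableEq X] {d : ℕ}
  {rate : Fin d → X → Config X d → ℝ} {ρ : Config X d → ℝ} {lam : ℕ → ℝ} {w : ℕ → Config X d → ℝ}

-- There are exactly `|Ω|` eigenfunctions, so orthonormality says that a square matrix has a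
-- one-sided inverse, which is then two-sided.
open Finset in
lemma SpectralGap.completeness (S : SpectralGap rate ρ lam w) (x y : Config X d) :
    ∑ k ∈ range (Fintype.card (Config X d)), w k x * (w k y * ρ y) = if x = y then 1 else 0 := by
  let A : Matrix (Fin (Fintype.card (Config X d))) (Config X d) ℝ :=
    Matrix.of fun k x => w k x * ρ x
  let B : Matrix (Config X d) (Fin (Fintype.card (Config X d))) ℝ := Matrix.of fun x k => w k x
  have h : A * B = 1 := by
    ext k l
    rw [Matrix.mul_apply, Matrix.one_apply]
    have := S.orthonormal k k.2 l l.2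
    rw [innerRho] at this
    simp only [Fin.ext_iff, ← this, A, B, Matrix.of_apply]
    exact Finset.sum_congr rfl fun x _ => by ring
  have h' : B * A = 1 := (Matrix.mul_eq_one_comm_of_card_eq _ _ _ (Fintype.card_fin _)).1 h
  have := congrFun (congrFun h' x) y
  rw [Matrix.mul_apply, Matrix.one_apply] at this
  rw [← this, Finset.sum_range]
  rfl

open Finset in
lemma SpectralGap.expand (S : SpectralGap rate ρ lam w) (f : Config X d → ℝ) :
    f = fun x => ∑ k ∈ range (Fintype.card (Config X d)), innerRho ρ f (w k) * w k x := by
  funext x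
  simp only [innerRho, Finset.sum_mul]
  rw [Finset.sum_comm]
  have : ∀ y, ∑ k ∈ range (Fintype.card (Config X d)), f y * w k y * ρ y * w k x =
      f y * if x = y then 1 else 0 := fun y => by
    rw [← S.completeness x y, Finset.mul_sum]
    exact Finset.sum_congr rfl fun k _ => by ring
  rw [Finset.sum_congr rfl fun y _ => this y]
  simp

open Finset in
lemma SpectralGap.parseval (S : SpectralGap rate ρ lam w) (f g : Config X d → ℝ) :
    innerRho ρ f g =
      ∑ k ∈ range (Fintype.card (Config X d)), innerRho ρ f (w k) * innerRho ρ g (w k) := by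
  conv_lhs => rw [S.expand f]
  rw [innerRho_sum_left]
  exact Finset.sum_congr rfl fun k _ => by rw [innerRho_comm ρ (w k) g]

open Finset in
lemma SpectralGap.coeff_sum (S : SpectralGap rate ρ lam w) (c : ℕ → ℝ) {l : ℕ}
    (hl : l < Fintype.card (Config X d)) :
    innerRho ρ (fun x => ∑ k ∈ range (Fintype.card (Config X d)), c k * w k x) (w l) = c l := by
  rw [innerRho_sum_left, Finset.sum_congr rfl (g := fun k => if k = l then c k else 0)]
  · rw [Finset.sum_ite_eq', if_pos (Finset.mem_range.2 hl)]
  · intro k hk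
    rw [S.orthonormal k (Finset.mem_range.1 hk) l hl]
    simp

open Finset in
lemma linearMap_apply_sum (T : (Config X d → ℝ) →ₗ[ℝ] (Config X d → ℝ)) (s : Finset ℕ)
    (c e : ℕ → ℝ) (h : ∀ k ∈ s, T (w k) = e k • w k) :
    T (fun x => ∑ k ∈ s, c k * w k x) = fun x => ∑ k ∈ s, (e k * c k) * w k x := by
  have : (fun x => ∑ k ∈ s, c k * w k x) = ∑ k ∈ s, c k • w k := by
    funext x; simp
  rw [this, map_sum]
  funext x
  rw [Finset.sum_apply]
  refine Finset.sum_congr rfl fun k hk => ?_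
  rw [map_smul, h k hk]
  simp only [Pi.smul_apply, smul_eq_mul]
  ring

lemma SpectralGap.coeff_map (S : SpectralGap rate ρ lam w)
    (T : (Config X d → ℝ) →ₗ[ℝ] (Config X d → ℝ)) (e : ℕ → ℝ)
    (h : ∀ k < Fintype.card (Config X d), T (w k) = e k • w k) (f : Config X d → ℝ) {l : ℕ}
    (hl : l < Fintype.card (Config X d)) :
    innerRho ρ (T f) (w l) = e l * innerRho ρ f (w l) := by
  conv_lhs => rw [S.expand f]
  rw [linearMap_apply_sum T _ _ e fun k hk => h k (Finset.mem_range.1 hk), S.coeff_sum _ hl]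

lemma SpectralGap.generator_eigen (S : SpectralGap rate ρ lam w) {k : ℕ}
    (hk : k < Fintype.card (Config X d)) : generator rate (w k) = (-lam k) • w k := by
  rw [neg_smul, ← S.eigen k hk, neg_neg]

lemma SpectralGap.transitionOp_eigen (S : SpectralGap rate ρ lam w) (t : ℝ) {k : ℕ}
    (hk : k < Fintype.card (Config X d)) :
    transitionOp rate t (w k) = Real.exp (-(lam k * t)) • w k := by
  rw [transitionOp, Matrix.toLin'_apply]
  apply Matrix.exp_mulVec_of_mulVec_eq_smul
  rw [Matrix.smul_mulVec, ← Matrix.toLin'_apply, Matrix.toLin'_toMatrix', S.generator_eigen hk,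
    smul_smul]
  congr 1
  ring

lemma SpectralGap.coeff_generator (S : SpectralGap rate ρ lam w) (f : Config X d → ℝ) {l : ℕ}
    (hl : l < Fintype.card (Config X d)) :
    innerRho ρ (generator rate f) (w l) = -lam l * innerRho ρ f (w l) :=
  S.coeff_map _ (fun k => -lam k) (fun _ hk => S.generator_eigen hk) f hl

lemma SpectralGap.coeff_transitionOp (S : SpectralGap rate ρ lam w) (t : ℝ) (f : Config X d → ℝ)
    {l : ℕ} (hl : l < Fintype.card (Config X d)) :
    innerRho ρ (transitionOp rate t f) (w l) = Real.exp (-(lam l * t)) * innerRho ρ f (w l) :=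
  S.coeff_map _ (fun k => Real.exp (-(lam k * t))) (fun _ hk => S.transitionOp_eigen t hk) f hl

open Finset in
lemma SpectralGap.innerRho_transitionOp (S : SpectralGap rate ρ lam w) (t : ℝ)
    (f g : Config X d → ℝ) :
    innerRho ρ (transitionOp rate t f) g = ∑ k ∈ range (Fintype.card (Config X d)),
      Real.exp (-(lam k * t)) * (innerRho ρ f (w k) * innerRho ρ g (w k)) := by
  rw [S.parseval]
  refine Finset.sum_congr rfl fun k hk => ?_
  rw [S.coeff_transitionOp t f (Finset.mem_range.1 hk), mul_assoc]

open Finset in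
lemma SpectralGap.innerRho_generator_transitionOp (S : SpectralGap rate ρ lam w) (t : ℝ)
    (f g : Config X d → ℝ) :
    innerRho ρ (generator rate (transitionOp rate t f)) g =
      ∑ k ∈ range (Fintype.card (Config X d)),
      Real.exp (-(lam k * t)) * (-lam k) * (innerRho ρ f (w k) * innerRho ρ g (w k)) := by
  rw [S.parseval]
  refine Finset.sum_congr rfl fun k hk => ?_
  rw [S.coeff_generator _ (Finset.mem_range.1 hk), S.coeff_transitionOp t f (Finset.mem_range.1 hk)]
  ring

lemma SpectralGap.lam_nonneg (S : SpectralGap rate ρ lam w) {k : ℕ}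
    (hk : k < Fintype.card (Config X d)) : 0 ≤ lam k := by
  rw [← S.lam_zero]; exact S.mono 0 k (Nat.zero_le k) hk

lemma SpectralGap.gap_le (S : SpectralGap rate ρ lam w) {k : ℕ} (h0 : k ≠ 0)
    (hk : k < Fintype.card (Config X d)) : lam 1 ≤ lam k :=
  S.mono 1 k (Nat.one_le_iff_ne_zero.2 h0) hk

open Finset in
/-- The Euler scheme converges to the semigroup. -/
lemma SpectralGap.tendsto_euler (S : SpectralGap rate ρ lam w) (t : ℝ) (f : Config X d → ℝ)
    (x : Config X d) :
    Filter.Tendsto (fun n : ℕ => ((1 + (t / n) • generator rate) ^ n : Module.End ℝ _) f x)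
      Filter.atTop (nhds (transitionOp rate t f x)) := by
  have hE : ∀ n : ℕ, ((1 + (t / n) • generator rate) ^ n : Module.End ℝ _) f x =
      ∑ k ∈ range (Fintype.card (Config X d)),
        ((1 + -(lam k * t) / n) ^ n * innerRho ρ f (w k)) * w k x := by
    intro n
    conv_lhs => rw [S.expand f]
    rw [linearMap_apply_sum ((1 + (t / n) • generator rate) ^ n : Module.End ℝ _) _ _
      (fun k => (1 + -(lam k * t) / n) ^ n)]
    intro k hk
    have h1 : (1 + (t / n) • generator rate : Module.End ℝ _) (w k) =
        (1 + -(lam k * t) / n) • w k := by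
      rw [LinearMap.add_apply, LinearMap.smul_apply, S.generator_eigen (Finset.mem_range.1 hk),
        Module.End.one_apply, smul_smul, add_smul, one_smul]
      congr 2
      ring
    have h2 : ∀ m : ℕ, ((1 + (t / n) • generator rate) ^ m : Module.End ℝ _) (w k) =
        (1 + -(lam k * t) / n) ^ m • w k := by
      intro m
      induction m with
      | zero => simp
      | succ m ih => rw [pow_succ, Module.End.mul_apply, h1, map_smul, ih, smul_smul, pow_succ,
          mul_comm]
    exact h2 n
  simp only [hE]
  rw [S.expand (transitionOp rate t f)]
  refine tendsto_finsetSum _ fun k hk => ?_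
  rw [S.coeff_transitionOp t f (Finset.mem_range.1 hk)]
  exact ((Real.tendsto_one_add_div_pow_exp _).mul_const _).mul_const _

end Spectral


/-! ### Oscillations, maximal rates and distances between sites -/

section Osc

variable {X : Type*} [Fintype X] {d : ℕ}

lemma abs_sub_le_osc (i : Fin d) (f : Config X d → ℝ) (x : Config X d) (a b : X) :
    |f (Function.update x i a) - f (Function.update x i b)| ≤ osc i f :=
  le_ciSup (f := fun p : Config X d × X × X =>
    |f (Function.update p.1 i p.2.1) - f (Function.update p.1 i p.2.2)|)
    (Set.finite_range _).bddAbove (x, a, b)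

lemma abs_update_sub_le_osc (i : Fin d) (f : Config X d → ℝ) (x : Config X d) (a : X) :
    |f (Function.update x i a) - f x| ≤ osc i f := by
  simpa using abs_sub_le_osc i f x a (x i)

lemma osc_nonneg (i : Fin d) (f : Config X d → ℝ) : 0 ≤ osc i f :=
  Real.iSup_nonneg fun _ => abs_nonneg _

lemma osc_le {i : Fin d} {f : Config X d → ℝ} {N : ℝ} (hN : 0 ≤ N)
    (h : ∀ x a b, f (Function.update x i a) - f (Function.update x i b) ≤ N) : osc i f ≤ N :=
  Real.iSup_le (fun p => abs_sub_le_iff.2 ⟨h p.1 p.2.1 p.2.2, h p.1 p.2.2 p.2.1⟩) hN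

lemma osc_eq_zero {i : Fin d} {f : Config X d → ℝ}
    (h : ∀ x a, f (Function.update x i a) = f x) : osc i f = 0 :=
  le_antisymm (osc_le le_rfl fun x a b => by rw [h, h, sub_self]) (osc_nonneg i f)

lemma osc_le_oscNorm (i : Fin d) (f : Config X d → ℝ) : osc i f ≤ oscNorm f :=
  Finset.single_le_sum (fun k _ => osc_nonneg k f) (Finset.mem_univ i)

lemma oscNorm_nonneg (f : Config X d → ℝ) : 0 ≤ oscNorm f :=
  Finset.sum_nonneg fun i _ => osc_nonneg i f

variable {rate : Fin d → X → Config X d → ℝ}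

lemma rate_le_rMax (i : Fin d) (α : X) (x : Config X d) : rate i α x ≤ rMax rate :=
  le_ciSup (f := fun p : Fin d × X × Config X d => rate p.1 p.2.1 p.2.2)
    (Set.finite_range _).bddAbove (i, α, x)

lemma sum_rate_le_rBar (x : Config X d) : ∑ i, ∑ α, rate i α x ≤ rBar rate :=
  le_ciSup (f := fun x : Config X d => ∑ i, ∑ α, rate i α x) (Set.finite_range _).bddAbove x

lemma rMax_nonneg (h : ∀ i α x, 0 ≤ rate i α x) : 0 ≤ rMax rate :=
  Real.iSup_nonneg fun _ => h _ _ _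

lemma rBar_nonneg (h : ∀ i α x, 0 ≤ rate i α x) : 0 ≤ rBar rate :=
  Real.iSup_nonneg fun _ => Finset.sum_nonneg fun _ _ => Finset.sum_nonneg fun _ _ => h _ _ _

end Osc

lemma siteDist_comm {d : ℕ} (i j : Fin d) : siteDist i j = siteDist j i := by
  unfold siteDist; omega

lemma siteDist_self {d : ℕ} (i : Fin d) : siteDist i i = 0 := by
  unfold siteDist; omega

lemma siteDist_triangle {d : ℕ} (i j k : Fin d) : siteDist i k ≤ siteDist i j + siteDist j k := by
  unfold siteDist; omega

lemma card_siteDist_le {d : ℕ} (i : Fin d) (m : ℕ) :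
    (Finset.univ.filter fun k : Fin d => siteDist i k ≤ m).card ≤ 2 * m + 1 := by
  have : (Finset.univ.filter fun k : Fin d => siteDist i k ≤ m).card ≤
      (Finset.Icc ((i : ℤ) - m) (i + m)).card := by
    refine Finset.card_le_card_of_injOn (fun k => (k : ℤ)) ?_ ?_
    · intro k hk
      have := (Finset.mem_filter.1 hk).2
      unfold siteDist at this
      simp only [Finset.coe_Icc, Set.mem_Icc]
      omega
    · intro a _ b _ h
      simpa [Fin.ext_iff] using h
  rw [Int.card_Icc] at this
  omega

/-! ### Lieb–Robinson bound by coupling -/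

section LiebRobinson

variable {X : Type*} [Fintype X] {d κ : ℕ} {rate : Fin d → X → Config X d → ℝ}

/-- Basic coupling of two copies: at the common rate `min rx ry` both jump together, and the excess
`|rx - ry|` moves one copy alone, at a cost of one oscillation. -/
lemma coupling_term_le {rx ry A B hx hy O o : ℝ} (hAB : A - B ≤ O) (hrx : 0 ≤ rx) (hry : 0 ≤ ry)
    (hA : |A - hx| ≤ o) (hB : |B - hy| ≤ o) :
    rx * (A - hx) - ry * (B - hy) ≤ min rx ry * (O - (hx - hy)) + |rx - ry| * o := by
  rw [abs_le] at hA hB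
  rcases le_total rx ry with h | h
  · rw [min_eq_left h, abs_of_nonpos (sub_nonpos.2 h)]
    nlinarith [mul_le_mul_of_nonneg_left hAB hrx, mul_nonneg (sub_nonneg.2 h)
      (by linarith [hB.1] : 0 ≤ o + (B - hy))]
  · rw [min_eq_right h, abs_of_nonneg (sub_nonneg.2 h)]
    nlinarith [mul_le_mul_of_nonneg_left hAB hry, mul_nonneg (sub_nonneg.2 h)
      (by linarith [hA.2] : 0 ≤ o - (A - hx))]

/-- Two copies differing only at `i` are coupled. Their rates differ only at sites within `κ` of
`i`, so only the oscillations there can feed the oscillation at `i`. -/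
lemma osc_euler_step (hr : ∀ i α x, 0 ≤ rate i α x) (hκ : FiniteRange rate κ) {ε : ℝ} (hε : 0 ≤ ε)
    (hε1 : ε * rBar rate ≤ 1) (h : Config X d → ℝ) (i : Fin d) :
    osc i ((1 + ε • generator rate : Module.End ℝ _) h) ≤
      osc i h + ε * (Fintype.card X * rMax rate *
        ∑ k ∈ Finset.univ.filter (fun k => siteDist i k ≤ κ), osc k h) := by
  have hR : 0 ≤ rMax rate := rMax_nonneg hr
  refine osc_le (add_nonneg (osc_nonneg i h) (mul_nonneg hε (mul_nonneg (by positivity)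
    (Finset.sum_nonneg fun k _ => osc_nonneg k h)))) fun z a b => ?_
  set x := Function.update z i a with hx
  set y := Function.update z i b with hy
  set m : ℝ := ∑ k, ∑ α, min (rate k α x) (rate k α y) with hm
  have hD : h x - h y ≤ osc i h := (abs_le.1 (abs_sub_le_osc i h z a b)).2
  have hterm : ∀ k α, rate k α x * (h (Function.update x k α) - h x) -
      rate k α y * (h (Function.update y k α) - h y) ≤
      min (rate k α x) (rate k α y) * (osc i h - (h x - h y)) +
        if siteDist i k ≤ κ then rMax rate * osc k h else 0 := by
    intro k α
    have hAB : h (Function.update x k α) - h (Function.update y k α) ≤ osc i h := by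
      -- A joint jump at `i` itself makes the two copies coincide.
      by_cases hki : k = i
      · subst hki
        rw [hx, hy, Function.update_idem, Function.update_idem, sub_self]
        exact osc_nonneg _ _
      · rw [hx, hy, Function.update_comm (Ne.symm hki), Function.update_comm (Ne.symm hki)]
        exact (abs_le.1 (abs_sub_le_osc i h _ a b)).2
    refine (coupling_term_le hAB (hr k α x) (hr k α y) (abs_update_sub_le_osc k h x α)
      (abs_update_sub_le_osc k h y α)).trans ?_
    refine add_le_add le_rfl ?_
    split_ifs with hk
    · refine mul_le_mul_of_nonneg_right ?_ (osc_nonneg k h)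
      rw [abs_le]
      constructor <;>
      linarith [hr k α x, hr k α y, rate_le_rMax (rate := rate) k α x,
        rate_le_rMax (rate := rate) k α y]
    · have : rate k α x = rate k α y := hκ k α x y fun j hj => by
        have hji : j ≠ i := by
          rintro rfl
          exact hk (by rwa [siteDist_comm])
        rw [hx, hy, Function.update_of_ne hji, Function.update_of_ne hji]
      simp [this]
  have hsum : generator rate h x - generator rate h y ≤ m * (osc i h - (h x - h y)) +
      Fintype.card X * rMax rate *
        ∑ k ∈ Finset.univ.filter (fun k => siteDist i k ≤ κ), osc k h := by
    have h1 : generator rate h x - generator rate h y =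
        ∑ k, ∑ α, (rate k α x * (h (Function.update x k α) - h x) -
          rate k α y * (h (Function.update y k α) - h y)) := by
      simp only [Finset.sum_sub_distrib]; rfl
    rw [h1]
    refine (Finset.sum_le_sum fun k _ => Finset.sum_le_sum fun α _ => hterm k α).trans
      (le_of_eq ?_)
    simp only [Finset.sum_add_distrib, ← Finset.sum_mul]
    congr 1
    rw [Finset.mul_sum, Finset.sum_filter]
    refine Finset.sum_congr rfl fun k _ => ?_
    rw [Finset.sum_const, Finset.card_univ, nsmul_eq_mul]
    split_ifs <;> ring
  -- `ε * m` acts as the probability of a joint jump: being at most one, it makes `(1 - ε * m) * (h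
  -- x - h y) + ε * m * osc i h` a convex combination, hence at most `osc i h`.
  have hm1 : ε * m ≤ 1 := by
    refine le_trans (mul_le_mul_of_nonneg_left ?_ hε) hε1
    exact (Finset.sum_le_sum fun k _ => Finset.sum_le_sum fun α _ => min_le_left _ _).trans
      (sum_rate_le_rBar x)
  have he : ∀ u, (1 + ε • generator rate : Module.End ℝ _) h u = h u + ε * generator rate h u :=
    fun u => rfl
  rw [he, he]
  nlinarith [mul_le_mul_of_nonneg_left hsum hε, mul_nonneg (sub_nonneg.2 hm1) (sub_nonneg.2 hD)]

/-- The weight `exp (-(D i / κ))` loses at most a factor `e` over one interaction range, and at most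
`2 * κ + 1` sites feed each site. The profile is thus preserved by every step, up to a growth
factor. -/
lemma osc_euler_pow (hr : ∀ i α x, 0 ≤ rate i α x) (hκ0 : 0 < κ) (hκ : FiniteRange rate κ) {ε : ℝ}
    (hε : 0 ≤ ε) (hε1 : ε * rBar rate ≤ 1) (D : Fin d → ℝ)
    (hD : ∀ i k, siteDist i k ≤ κ → D i - κ ≤ D k) {f : Config X d → ℝ} {N : ℝ} (hN : 0 ≤ N)
    (hf : ∀ i, osc i f ≤ N * Real.exp (-(D i / κ))) (n : ℕ) (i : Fin d) :
    osc i (((1 + ε • generator rate) ^ n : Module.End ℝ _) f) ≤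
      N * (1 + ε * (Real.exp 1 * (2 * κ + 1) * (Fintype.card X * rMax rate))) ^ n *
        Real.exp (-(D i / κ)) := by
  have hR : 0 ≤ rMax rate := rMax_nonneg hr
  induction n generalizing i with
  | zero => simpa using hf i
  | succ n ih =>
    rw [pow_succ', Module.End.mul_apply]
    refine (osc_euler_step hr hκ hε hε1 _ i).trans ?_
    set Γ := Real.exp 1 * (2 * κ + 1) * (Fintype.card X * rMax rate) with hΓ
    set B := N * (1 + ε * Γ) ^ n with hB
    have hΓ0 : 0 ≤ Γ := by positivity
    have hB0 : 0 ≤ B := by positivity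
    have hκ' : (0 : ℝ) < κ := by exact_mod_cast hκ0
    have hs : ∑ k ∈ Finset.univ.filter (fun k => siteDist i k ≤ κ),
        osc k (((1 + ε • generator rate) ^ n : Module.End ℝ _) f) ≤
        (2 * κ + 1) * (B * (Real.exp 1 * Real.exp (-(D i / κ)))) := by
      refine (Finset.sum_le_card_nsmul _ _ (B * (Real.exp 1 * Real.exp (-(D i / κ)))) ?_).trans ?_
      · intro k hk
        refine (ih k).trans (mul_le_mul_of_nonneg_left ?_ hB0)
        rw [← Real.exp_add, Real.exp_le_exp]
        have := hD i k (Finset.mem_filter.1 hk).2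
        have h2 : (D i - κ) / κ ≤ D k / κ := by gcongr
        rw [sub_div, div_self hκ'.ne'] at h2
        linarith
      · rw [nsmul_eq_mul]
        refine mul_le_mul_of_nonneg_right ?_ (by positivity)
        exact_mod_cast card_siteDist_le i κ
    have h2 := mul_le_mul_of_nonneg_left hs
      (by positivity : 0 ≤ ε * (Fintype.card X * rMax rate))
    calc _ ≤ B * Real.exp (-(D i / κ)) + ε * (Fintype.card X * rMax rate) *
          ((2 * κ + 1) * (B * (Real.exp 1 * Real.exp (-(D i / κ))))) := by
          rw [← mul_assoc]; exact add_le_add (ih i) h2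
      _ = _ := by rw [hB, pow_succ]; simp only [hΓ]; ring

/-- Lieb–Robinson bound: oscillations spread at finite velocity, up to exponential tails. -/
lemma osc_transitionOp_le [DecidableEq X] {ρ : Config X d → ℝ} {lam : ℕ → ℝ}
    {w : ℕ → Config X d → ℝ} (S : SpectralGap rate ρ lam w) (hr : ∀ i α x, 0 ≤ rate i α x)
    (hκ0 : 0 < κ) (hκ : FiniteRange rate κ) (D : Fin d → ℝ)
    (hD : ∀ i k, siteDist i k ≤ κ → D i - κ ≤ D k) {f : Config X d → ℝ} {N : ℝ} (hN : 0 ≤ N)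
    (hf : ∀ i, osc i f ≤ N * Real.exp (-(D i / κ))) {t : ℝ} (ht : 0 ≤ t) (i : Fin d) :
    osc i (transitionOp rate t f) ≤
      N * Real.exp (Real.exp 1 * (2 * κ + 1) * (Fintype.card X * rMax rate) * t) *
        Real.exp (-(D i / κ)) := by
  refine osc_le (by positivity) fun x a b => ?_
  have h1 := (S.tendsto_euler t f (Function.update x i a)).sub
    (S.tendsto_euler t f (Function.update x i b))
  have h2 := ((Real.tendsto_one_add_div_pow_exp
    (Real.exp 1 * (2 * κ + 1) * (Fintype.card X * rMax rate) * t)).const_mul N).mul_const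
      (Real.exp (-(D i / κ)))
  refine le_of_tendsto_of_tendsto h1 h2 ?_
  -- Beyond this threshold the step `t / n` is short enough for the coupling.
  filter_upwards [Filter.eventually_ge_atTop (⌈t * rBar rate⌉₊ + 1)] with n hn
  have hn0 : (0 : ℝ) < n := by exact_mod_cast (Nat.succ_pos _).trans_le hn
  have hle : t * rBar rate ≤ n :=
    (Nat.le_ceil _).trans (by exact_mod_cast (Nat.le_succ _).trans hn)
  have h3 := osc_euler_pow hr hκ0 hκ (ε := t / n) (by positivity)
    (by rw [div_mul_eq_mul_div, div_le_one hn0]; exact hle) D hD hN hf n i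
  refine ((abs_le.1 (abs_sub_le_osc i _ x a b)).2.trans h3).trans (le_of_eq ?_)
  congr 4
  ring

end LiebRobinson

/-! ### Reversibility, Dirichlet form and bounds on the generator -/

section Reversal

variable {X : Type*} [Fintype X] {d : ℕ} {rate : Fin d → X → Config X d → ℝ} {ρ : Config X d → ℝ}

/-- Undoing a jump, `(x, α) ↦ (τ_{i,α} x, x_i)`, is an involution, and detailed balance says that it
preserves the weight `ρ x * rate i α x`. -/
lemma IsReversible.sum_swap (H : IsReversible rate ρ) (i : Fin d)
    (F : Config X d → Config X d → ℝ) :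
    ∑ x, ∑ α, ρ x * rate i α x * F x (Function.update x i α) =
      ∑ x, ∑ α, ρ x * rate i α x * F (Function.update x i α) x := by
  let σ : Config X d × X → Config X d × X := fun p => (Function.update p.1 i p.2, p.1 i)
  have hσ : Function.Involutive σ := fun p => by simp [σ]
  rw [← Fintype.sum_prod_type' (f := fun x α => ρ x * rate i α x * F x (Function.update x i α)),
    ← Fintype.sum_prod_type' (f := fun x α => ρ x * rate i α x * F (Function.update x i α) x),
    ← Equiv.sum_comp hσ.toPerm]
  refine Finset.sum_congr rfl fun p _ => ?_
  simp only [Function.Involutive.coe_toPerm, σ, Function.update_idem, Function.update_eq_self]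
  rw [H.detailed_balance i p.2 p.1]

/-- Average of the direct expression and of the one obtained by reversing every jump. -/
lemma IsReversible.dirichlet_form (H : IsReversible rate ρ) (f g : Config X d → ℝ) :
    innerRho ρ (generator rate f) g = -(1 / 2) * ∑ i, ∑ x, ∑ α, ρ x * rate i α x *
      ((f (Function.update x i α) - f x) * (g (Function.update x i α) - g x)) := by
  have h1 : innerRho ρ (generator rate f) g = ∑ i, ∑ x, ∑ α, ρ x * rate i α x *
      ((f (Function.update x i α) - f x) * g x) := by
    rw [Finset.sum_comm]
    refine Finset.sum_congr rfl fun x _ => ?_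
    change (∑ i, ∑ α, rate i α x * (f (Function.update x i α) - f x)) * g x * ρ x = _
    simp only [Finset.sum_mul]
    exact Finset.sum_congr rfl fun i _ => Finset.sum_congr rfl fun α _ => by ring
  have h2 : innerRho ρ (generator rate f) g = ∑ i, ∑ x, ∑ α, ρ x * rate i α x *
      ((f x - f (Function.update x i α)) * g (Function.update x i α)) := by
    rw [h1]
    exact Finset.sum_congr rfl fun i _ => H.sum_swap i fun x y => (f y - f x) * g x
  have h3 : innerRho ρ (generator rate f) g + innerRho ρ (generator rate f) g =
      -∑ i, ∑ x, ∑ α, ρ x * rate i α x *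
      ((f (Function.update x i α) - f x) * (g (Function.update x i α) - g x)) := by
    nth_rewrite 1 [h1]
    rw [h2]
    simp only [← Finset.sum_add_distrib, ← Finset.sum_neg_distrib]
    exact Finset.sum_congr rfl fun i _ => Finset.sum_congr rfl fun x _ =>
      Finset.sum_congr rfl fun α _ => by ring
  linarith

lemma IsReversible.weight_nonneg (H : IsReversible rate ρ) (i : Fin d) (α : X) (x : Config X d) :
    0 ≤ ρ x * rate i α x :=
  mul_nonneg (H.density_pos x).le (H.rate_nonneg i α x)

/-- The total jump rate at a site, tested against a non-negative function. -/
lemma IsReversible.sum_weight_mul_le (H : IsReversible rate ρ) (i : Fin d) {F : Config X d → ℝ}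
    (hF : ∀ x, 0 ≤ F x) :
    ∑ x, ∑ α, ρ x * rate i α x * F x ≤ Fintype.card X * rMax rate * ∑ x, F x * ρ x := by
  rw [Finset.mul_sum]
  refine Finset.sum_le_sum fun x _ => ?_
  calc ∑ α, ρ x * rate i α x * F x ≤ ∑ _α : X, ρ x * rMax rate * F x :=
        Finset.sum_le_sum fun α _ => mul_le_mul_of_nonneg_right
          (mul_le_mul_of_nonneg_left (rate_le_rMax i α x) (H.density_pos x).le) (hF x)
    _ = _ := by rw [Finset.sum_const, Finset.card_univ, nsmul_eq_mul]; ring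

/-- For an evolved `f` and a local `g`, only the oscillation of `f` on the few sites of `g` matters;
this is where locality enters the time derivative of a correlation. -/
lemma IsReversible.abs_dirichlet_le (H : IsReversible rate ρ) (f g : Config X d → ℝ) :
    |innerRho ρ (generator rate f) g| ≤
      Fintype.card X * rMax rate / 2 * ∑ i, osc i f * osc i g := by
  rw [H.dirichlet_form, abs_mul, Finset.mul_sum]
  have h1 : |∑ i, ∑ x, ∑ α, ρ x * rate i α x *
      ((f (Function.update x i α) - f x) * (g (Function.update x i α) - g x))| ≤
      ∑ i, Fintype.card X * rMax rate * (osc i f * osc i g) := by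
    refine (Finset.abs_sum_le_sum_abs _ _).trans (Finset.sum_le_sum fun i _ => ?_)
    refine (Finset.abs_sum_le_sum_abs _ _).trans ?_
    have h2 := H.sum_weight_mul_le i (F := fun _ => osc i f * osc i g)
      fun _ => mul_nonneg (osc_nonneg _ _) (osc_nonneg _ _)
    rw [← Finset.mul_sum, H.density_sum, mul_one] at h2
    refine (Finset.sum_le_sum fun x _ => ?_).trans h2
    refine (Finset.abs_sum_le_sum_abs _ _).trans (Finset.sum_le_sum fun α _ => ?_)
    rw [abs_mul (_ * _) (_ * _), abs_mul (f _ - _), abs_of_nonneg (H.weight_nonneg i α x)]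
    exact mul_le_mul_of_nonneg_left (mul_le_mul (abs_update_sub_le_osc _ _ _ _)
      (abs_update_sub_le_osc _ _ _ _) (abs_nonneg _) (osc_nonneg _ _)) (H.weight_nonneg i α x)
  have h3 : |(-(1 / 2) : ℝ)| = 1 / 2 := by norm_num
  rw [h3]
  refine (mul_le_mul_of_nonneg_left h1 (by norm_num)).trans (le_of_eq ?_)
  rw [Finset.mul_sum]
  exact Finset.sum_congr rfl fun i _ => by ring

/-- For `g` living on one site, the increment of `g` is bounded by its two end values, which
reversal makes equal on average. An `L¹` norm of `g` then replaces its oscillation, and the factor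
`1 / 2` disappears. -/
lemma IsReversible.abs_dirichlet_single_le (H : IsReversible rate ρ) (f g : Config X d → ℝ)
    (q : Fin d) (hg : ∀ i ≠ q, ∀ x α, g (Function.update x i α) = g x) :
    |innerRho ρ (generator rate f) g| ≤
      Fintype.card X * rMax rate * osc q f * ∑ x, |g x| * ρ x := by
  rw [H.dirichlet_form, abs_mul, Finset.sum_eq_single q (fun i _ hi => Finset.sum_eq_zero
    fun x _ => Finset.sum_eq_zero fun α _ => by rw [hg i hi]; simp) (by simp)]
  have h1 : |∑ x, ∑ α, ρ x * rate q α x *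
      ((f (Function.update x q α) - f x) * (g (Function.update x q α) - g x))| ≤
      ∑ x, ∑ α, ρ x * rate q α x * (osc q f * |g (Function.update x q α)|) +
        ∑ x, ∑ α, ρ x * rate q α x * (osc q f * |g x|) := by
    rw [← Finset.sum_add_distrib]
    refine (Finset.abs_sum_le_sum_abs _ _).trans (Finset.sum_le_sum fun x _ => ?_)
    rw [← Finset.sum_add_distrib]
    refine (Finset.abs_sum_le_sum_abs _ _).trans (Finset.sum_le_sum fun α _ => ?_)
    rw [abs_mul (_ * _) (_ * _), abs_mul (f _ - _), abs_of_nonneg (H.weight_nonneg q α x), ← mul_add, ← mul_add]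
    exact mul_le_mul_of_nonneg_left (mul_le_mul (abs_update_sub_le_osc _ _ _ _)
      (abs_sub _ _) (abs_nonneg _) (osc_nonneg _ _)) (H.weight_nonneg q α x)
  rw [H.sum_swap q fun _ y => osc q f * |g y|] at h1
  have h2 := H.sum_weight_mul_le q (F := fun x => osc q f * |g x|)
    fun _ => mul_nonneg (osc_nonneg _ _) (abs_nonneg _)
  have h3 : ∑ x, osc q f * |g x| * ρ x = osc q f * ∑ x, |g x| * ρ x := by
    rw [Finset.mul_sum]; exact Finset.sum_congr rfl fun x _ => by ring
  have h4 : |(-(1 / 2) : ℝ)| = 1 / 2 := by norm_num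
  rw [h4]
  rw [h3] at h2
  linarith

lemma normRho_le_of_abs_le (hρ : ∀ x, 0 < ρ x) (h1 : ∑ x, ρ x = 1) {f : Config X d → ℝ} {B : ℝ}
    (hB : 0 ≤ B) (h : ∀ x, |f x| ≤ B) : normRho ρ f ≤ B := by
  rw [normRho, Real.sqrt_le_left hB]
  calc innerRho ρ f f ≤ ∑ x, B ^ 2 * ρ x := Finset.sum_le_sum fun x _ =>
        mul_le_mul_of_nonneg_right ((pow_two (f x)).symm.le.trans
          (sq_le_sq.2 ((h x).trans (le_abs_self B)))) (hρ x).le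
    _ = B ^ 2 := by rw [← Finset.mul_sum, h1, mul_one]

lemma IsReversible.normRho_generator_le (H : IsReversible rate ρ) (g : Config X d → ℝ) :
    normRho ρ (generator rate g) ≤ Fintype.card X * rMax rate * oscNorm g := by
  have hR : 0 ≤ rMax rate := rMax_nonneg H.rate_nonneg
  refine normRho_le_of_abs_le H.density_pos H.density_sum
    (mul_nonneg (by positivity) (oscNorm_nonneg g)) fun x => ?_
  change |∑ i, ∑ α, rate i α x * (g (Function.update x i α) - g x)| ≤ _
  rw [oscNorm, Finset.mul_sum]
  refine (Finset.abs_sum_le_sum_abs _ _).trans (Finset.sum_le_sum fun i _ => ?_)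
  refine (Finset.abs_sum_le_sum_abs _ _).trans ?_
  calc _ ≤ ∑ _α : X, rMax rate * osc i g := Finset.sum_le_sum fun α _ => by
        rw [abs_mul, abs_of_nonneg (H.rate_nonneg i α x)]
        exact mul_le_mul (rate_le_rMax i α x) (abs_update_sub_le_osc _ _ _ _) (abs_nonneg _) hR
    _ = _ := by rw [Finset.sum_const, Finset.card_univ, nsmul_eq_mul]; ring

/-- Cauchy–Schwarz over the jumps weighted by their rates, then `(a - b) ^ 2 ≤ 2 * (a ^ 2 + b ^ 2)`;
reversal identifies the two resulting sums. -/
lemma IsReversible.normRho_generator_single_le (H : IsReversible rate ρ) (g : Config X d → ℝ)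
    (q : Fin d) (hg : ∀ i ≠ q, ∀ x α, g (Function.update x i α) = g x) :
    normRho ρ (generator rate g) ≤ 2 * (Fintype.card X * rMax rate) * normRho ρ g := by
  have hR : 0 ≤ rMax rate := rMax_nonneg H.rate_nonneg
  set R := Fintype.card X * rMax rate with hRdef
  have hR0 : 0 ≤ R := by positivity
  rw [normRho, Real.sqrt_le_left (mul_nonneg (by positivity) (normRho_nonneg ρ g)), mul_pow,
    normRho_sq H.density_pos]
  have hL : ∀ x, generator rate g x =
      ∑ α, rate q α x * (g (Function.update x q α) - g x) := fun x => by
    change ∑ i, ∑ α, rate i α x * (g (Function.update x i α) - g x) = _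
    rw [Finset.sum_eq_single q (fun i _ hi => Finset.sum_eq_zero fun α _ => by
      rw [hg i hi]; simp) (by simp)]
  have hrR : ∀ x, ∑ α, rate q α x ≤ R := fun x => by
    calc ∑ α, rate q α x ≤ ∑ _α : X, rMax rate := Finset.sum_le_sum fun α _ => rate_le_rMax q α x
      _ = R := by rw [Finset.sum_const, Finset.card_univ, nsmul_eq_mul]
  have hpt : ∀ x, generator rate g x * generator rate g x * ρ x ≤
      2 * R * (∑ α, ρ x * rate q α x * g (Function.update x q α) ^ 2 +
        ∑ α, ρ x * rate q α x * g x ^ 2) := by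
    intro x
    have hcs := Finset.sum_mul_sq_le_sq_mul_sq Finset.univ (fun α => √(rate q α x))
      (fun α => √(rate q α x) * (g (Function.update x q α) - g x))
    have hs : ∀ α, √(rate q α x) ^ 2 = rate q α x := fun α => Real.sq_sqrt (H.rate_nonneg q α x)
    simp only [← mul_assoc, ← pow_two (√_), mul_pow, hs] at hcs
    rw [← hL] at hcs
    have h2 : ∑ α, rate q α x * (g (Function.update x q α) - g x) ^ 2 ≤
        2 * (∑ α, rate q α x * g (Function.update x q α) ^ 2 + ∑ α, rate q α x * g x ^ 2) := by
      rw [← Finset.sum_add_distrib, Finset.mul_sum]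
      refine Finset.sum_le_sum fun α _ => ?_
      nlinarith [mul_nonneg (H.rate_nonneg q α x)
        (sq_nonneg (g (Function.update x q α) + g x))]
    have h0 : 0 ≤ ∑ α, rate q α x * (g (Function.update x q α) - g x) ^ 2 :=
      Finset.sum_nonneg fun α _ => mul_nonneg (H.rate_nonneg q α x) (sq_nonneg _)
    have h3 : generator rate g x ^ 2 ≤ R * (2 * (∑ α, rate q α x * g (Function.update x q α) ^ 2 +
        ∑ α, rate q α x * g x ^ 2)) :=
      hcs.trans (mul_le_mul (hrR x) h2 h0 hR0)
    have h4 := mul_le_mul_of_nonneg_right h3 (H.density_pos x).le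
    rw [← pow_two]
    refine h4.trans (le_of_eq ?_)
    simp only [mul_assoc (ρ x), ← Finset.mul_sum]
    ring
  have h5 := H.sum_weight_mul_le q (F := fun x => g x ^ 2) fun _ => sq_nonneg _
  have h6 : ∑ x, g x ^ 2 * ρ x = innerRho ρ g g :=
    Finset.sum_congr rfl fun x _ => by rw [pow_two]
  rw [h6] at h5
  calc innerRho ρ (generator rate g) (generator rate g) ≤ _ := Finset.sum_le_sum fun x _ => hpt x
    _ = 2 * R * (2 * ∑ x, ∑ α, ρ x * rate q α x * g x ^ 2) := by
      rw [← Finset.mul_sum, Finset.sum_add_distrib, H.sum_swap q fun _ y => g y ^ 2]; ring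
    _ ≤ 2 * R * (2 * (R * innerRho ρ g g)) := by gcongr
    _ = _ := by ring

end Reversal


/-- The expectation of `f` in equilibrium. -/
noncomputable def meanRho {X : Type*} [Fintype X] {d : ℕ} (ρ f : Config X d → ℝ) : ℝ :=
  ∑ x, f x * ρ x

/-! ### Decay of covariances -/

section Covariance

variable {X : Type*} [Fintype X] [DecidableEq X] {d : ℕ}
  {rate : Fin d → X → Config X d → ℝ} {ρ : Config X d → ℝ} {lam : ℕ → ℝ} {w : ℕ → Config X d → ℝ}

lemma SpectralGap.innerRho_w_zero (S : SpectralGap rate ρ lam w) (f : Config X d → ℝ) :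
    innerRho ρ f (w 0) = meanRho ρ f :=
  Finset.sum_congr rfl fun x _ => by rw [S.w_zero, mul_one]

open Finset in
lemma SpectralGap.sum_abs_coeff_le (S : SpectralGap rate ρ lam w) (f g : Config X d → ℝ) :
    ∑ k ∈ range (Fintype.card (Config X d)), |innerRho ρ f (w k)| * |innerRho ρ g (w k)| ≤
      normRho ρ f * normRho ρ g := by
  have h := Real.sum_mul_le_sqrt_mul_sqrt (range (Fintype.card (Config X d)))
    (fun k => |innerRho ρ f (w k)|) (fun k => |innerRho ρ g (w k)|)
  simp only [sq_abs] at h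
  simp only [pow_two, ← S.parseval] at h
  exact h

-- The mode `k = 0` is the product of means. On the others `lam 1 ≤ lam k`, and the factor `lam k`
-- so gained turns the coefficient of `g` into that of `generator rate g`.
open Finset in
lemma SpectralGap.abs_cov_le (S : SpectralGap rate ρ lam w) (f g : Config X d → ℝ) {t : ℝ}
    (ht : 0 ≤ t) :
    |innerRho ρ (transitionOp rate t f) g - meanRho ρ f * meanRho ρ g| ≤
      normRho ρ f * normRho ρ (generator rate g) / lam 1 * Real.exp (-(lam 1 * t)) := by
  have h0 : 0 ∈ range (Fintype.card (Config X d)) :=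
    mem_range.2 (zero_lt_one.trans S.one_lt_card)
  rw [S.innerRho_transitionOp, ← Finset.add_sum_erase _ _ h0, S.lam_zero, zero_mul, neg_zero,
    Real.exp_zero, one_mul, S.innerRho_w_zero, S.innerRho_w_zero, add_sub_cancel_left,
    div_mul_eq_mul_div, le_div_iff₀ S.gap]
  calc _ ≤ (∑ k ∈ (range (Fintype.card (Config X d))).erase 0,
        |Real.exp (-(lam k * t)) * (innerRho ρ f (w k) * innerRho ρ g (w k))|) * lam 1 :=
        mul_le_mul_of_nonneg_right (Finset.abs_sum_le_sum_abs _ _) S.gap.le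
    _ ≤ ∑ k ∈ (range (Fintype.card (Config X d))).erase 0, Real.exp (-(lam 1 * t)) *
        (|innerRho ρ f (w k)| * |innerRho ρ (generator rate g) (w k)|) := by
        rw [Finset.sum_mul]
        refine Finset.sum_le_sum fun k hk => ?_
        have hk0 := (mem_erase.1 hk).1
        have hkN := mem_range.1 (mem_erase.1 hk).2
        have hl := S.gap_le hk0 hkN
        rw [S.coeff_generator _ hkN, abs_mul, abs_mul, abs_mul, abs_neg,
          abs_of_nonneg (S.lam_nonneg hkN), abs_of_pos (Real.exp_pos _)]
        have he : Real.exp (-(lam k * t)) ≤ Real.exp (-(lam 1 * t)) :=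
          Real.exp_le_exp.2 (neg_le_neg (mul_le_mul_of_nonneg_right hl ht))
        calc _ = Real.exp (-(lam k * t)) *
              (|innerRho ρ f (w k)| * (lam 1 * |innerRho ρ g (w k)|)) := by ring
          _ ≤ _ := mul_le_mul he (mul_le_mul_of_nonneg_left
            (mul_le_mul_of_nonneg_right hl (abs_nonneg _)) (abs_nonneg _))
            (mul_nonneg (abs_nonneg _) (mul_nonneg S.gap.le (abs_nonneg _))) (Real.exp_pos _).le
    _ ≤ Real.exp (-(lam 1 * t)) * (normRho ρ f * normRho ρ (generator rate g)) := by
        rw [← Finset.mul_sum]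
        refine mul_le_mul_of_nonneg_left (le_trans ?_ (S.sum_abs_coeff_le _ _)) (Real.exp_pos _).le
        exact Finset.sum_le_sum_of_subset_of_nonneg (Finset.erase_subset _ _)
          fun _ _ _ => by positivity
    _ = _ := mul_comm _ _

lemma SpectralGap.hasDerivAt_innerRho (S : SpectralGap rate ρ lam w) (f g : Config X d → ℝ)
    (t : ℝ) :
    HasDerivAt (fun s => innerRho ρ (transitionOp rate s f) g)
      (innerRho ρ (generator rate (transitionOp rate t f)) g) t := by
  simp only [S.innerRho_transitionOp, S.innerRho_generator_transitionOp]
  refine HasDerivAt.fun_sum fun k _ => HasDerivAt.mul_const ?_ _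
  have : HasDerivAt (fun s => -(lam k * s)) (-lam k) t := by
    simpa using ((hasDerivAt_id t).const_mul (lam k)).fun_neg
  exact this.exp

/-- Decay of covariances: gap decay at late times, finite velocity at early times. -/
lemma SpectralGap.abs_cov_le_of_lightcone (S : SpectralGap rate ρ lam w) {f g : Config X d → ℝ}
    {κ : ℕ} (hκ : 0 < κ) {a b V δ t : ℝ} (hb0 : 0 ≤ b) (hV : 0 < V) (hδ : 0 < δ)
    (ht : 0 ≤ t) (ha : normRho ρ f * normRho ρ (generator rate g) ≤ a)
    (hb : ∀ s, 0 ≤ s → |innerRho ρ (generator rate (transitionOp rate s f)) g| ≤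
      b * Real.exp (4 / 5 * V * s - δ / κ)) :
    |innerRho ρ (transitionOp rate t f) g - meanRho ρ f * meanRho ρ g| ≤
      (a * (1 / lam 1) + 7 / 8 * b * (1 / V)) *
        Real.exp (-(lam 1 * δ / (V * κ + lam 1 * κ))) := by
  have hκ' : (0 : ℝ) < κ := by exact_mod_cast hκ
  have hl := S.gap
  -- The time at which the two regimes balance: `V * T - δ / κ = -(lam 1 * T)`.
  set T := δ / (V * κ + lam 1 * κ) with hT
  have hT0 : 0 < T := by positivity
  have hδT : δ / κ = V * T + lam 1 * T := by rw [hT]; field_simp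
  have hexp : lam 1 * δ / (V * κ + lam 1 * κ) = lam 1 * T := by rw [hT]; ring
  rw [hexp]
  have htail : ∀ s, 0 ≤ s → |innerRho ρ (transitionOp rate s f) g - meanRho ρ f * meanRho ρ g| ≤
      a * (1 / lam 1) * Real.exp (-(lam 1 * s)) := fun s hs =>
    (S.abs_cov_le f g hs).trans <| by
      rw [mul_one_div]
      gcongr
  rcases le_total T t with h | h
  · refine (htail t ht).trans ?_
    have ha0 : 0 ≤ a := le_trans (mul_nonneg (normRho_nonneg _ _) (normRho_nonneg _ _)) ha
    have : Real.exp (-(lam 1 * t)) ≤ Real.exp (-(lam 1 * T)) :=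
      Real.exp_le_exp.2 (neg_le_neg (mul_le_mul_of_nonneg_left h hl.le))
    have h2 : 0 ≤ 7 / 8 * b * (1 / V) := by positivity
    calc _ ≤ a * (1 / lam 1) * Real.exp (-(lam 1 * T)) := by gcongr
      _ ≤ _ := mul_le_mul_of_nonneg_right (by linarith) (Real.exp_pos _).le
  -- Before `T`, the correlation is compared with its value at `T` by integrating the bound on the
  -- derivative, of which `B` is a primitive.
  · let B : ℝ → ℝ := fun s => b * Real.exp (4 / 5 * V * s - δ / κ) / (4 / 5 * V)
    have hB : ∀ s, HasDerivAt B (b * Real.exp (4 / 5 * V * s - δ / κ)) s := by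
      intro s
      have h1 : HasDerivAt (fun s => 4 / 5 * V * s - δ / κ) (4 / 5 * V) s := by
        simpa using ((hasDerivAt_id s).const_mul (4 / 5 * V)).sub_const (δ / κ)
      have h2 := (h1.exp.const_mul b).div_const (4 / 5 * V)
      rwa [← mul_assoc, mul_div_cancel_right₀ _ (by positivity)] at h2
    have hmid := image_norm_le_of_norm_deriv_right_le_deriv_boundary (a := t) (b := T)
      (f := fun s => innerRho ρ (transitionOp rate s f) g - innerRho ρ (transitionOp rate t f) g)
      (f' := fun s => innerRho ρ (generator rate (transitionOp rate s f)) g)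
      (B := fun s => B s - B t)
      (fun s _ => ((S.hasDerivAt_innerRho f g s).sub_const _).continuousAt.continuousWithinAt)
      (fun s _ => ((S.hasDerivAt_innerRho f g s).sub_const _).hasDerivWithinAt)
      (by simp) (fun s => (hB s).sub_const _) (fun s hs => hb s (ht.trans hs.1))
      (Set.right_mem_Icc.2 h)
    rw [Real.norm_eq_abs] at hmid
    have hBle : B T - B t ≤ 7 / 8 * b * (1 / V) * Real.exp (-(lam 1 * T)) := by
      set y := Real.exp (1 / 5 * V * T) with hy
      set z := Real.exp (-(V * T + lam 1 * T)) with hz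
      have hy0 : 0 < y := Real.exp_pos _
      have e1 : Real.exp (4 / 5 * V * T - δ / κ) = y ^ 4 * z := by
        rw [hy, ← Real.exp_nat_mul, hz, ← Real.exp_add, hδT]; congr 1; push_cast; ring
      have e2 : Real.exp (-(lam 1 * T)) = y ^ 5 * z := by
        rw [hy, ← Real.exp_nat_mul, hz, ← Real.exp_add]; congr 1; push_cast; ring
      have e3 : z ≤ Real.exp (4 / 5 * V * t - δ / κ) := by
        rw [hz, Real.exp_le_exp, hδT]
        have : 0 ≤ 4 / 5 * V * t := by positivity
        linarith
      -- The growth rate is only `4 / 5 * V`, so the integral is `5 / 4 * (y ^ 4 - 1) * z` against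
      -- an allowance proportional to `y ^ 5 * z`. This gives the factor `5 / 4 * 7 / 10 = 7 / 8`.
      have hpoly : y ^ 4 - 1 ≤ 7 / 10 * y ^ 5 := by
        nlinarith [sq_nonneg (y ^ 2 - 5 / 4 * y), sq_nonneg (y - 5 / 4), sq_nonneg (y ^ 2 - 5 / 3),
          mul_nonneg hy0.le (sq_nonneg (y ^ 2 - 5 / 4 * y)), mul_nonneg hy0.le
            (sq_nonneg (y ^ 2 - 5 / 3)), mul_nonneg hy0.le (sq_nonneg (y - 5 / 4)), hy0]
      have hz0 : 0 < z := Real.exp_pos _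
      rw [e2]
      calc B T - B t = b * (1 / V) * (5 / 4) *
            (Real.exp (4 / 5 * V * T - δ / κ) - Real.exp (4 / 5 * V * t - δ / κ)) := by
            simp only [B]; field_simp
        _ ≤ b * (1 / V) * (5 / 4) * (y ^ 4 * z - z) := by rw [e1]; gcongr
        _ = b * (1 / V) * (5 / 4) * z * (y ^ 4 - 1) := by ring
        _ ≤ b * (1 / V) * (5 / 4) * z * (7 / 10 * y ^ 5) := by gcongr
        _ = _ := by ring
    have hT' := htail T hT0.le
    rw [abs_sub_comm] at hmid
    calc _ ≤ |innerRho ρ (transitionOp rate t f) g - innerRho ρ (transitionOp rate T f) g| +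
          |innerRho ρ (transitionOp rate T f) g - meanRho ρ f * meanRho ρ g| := abs_sub_le _ _ _
      _ ≤ _ := by rw [add_mul]; linarith

end Covariance


/-! ### Velocity and light cone -/

section Rates

variable {X : Type*} [Fintype X] {d κ : ℕ}
  {rate : Fin d → X → Config X d → ℝ} {ρ : Config X d → ℝ} {lam : ℕ → ℝ} {w : ℕ → Config X d → ℝ}

/-- Without jumps the Dirichlet form of `w 1` would vanish, whereas it equals `-lam 1` by the
eigenvalue equation. -/
lemma SpectralGap.total_rate_pos [DecidableEq X] (S : SpectralGap rate ρ lam w)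
    (H : IsReversible rate ρ) : 0 < Fintype.card X * rMax rate := by
  refine lt_of_le_of_ne (mul_nonneg (Nat.cast_nonneg _) (rMax_nonneg H.rate_nonneg)) fun h => ?_
  have h1 := H.abs_dirichlet_le (w 1) (w 1)
  rw [← h, zero_div, zero_mul, S.coeff_generator _ S.one_lt_card,
    S.orthonormal 1 S.one_lt_card 1 S.one_lt_card, if_pos rfl, mul_one, abs_neg,
    abs_of_pos S.gap] at h1
  exact absurd h1 (not_le.2 S.gap)

/-- The velocity in units of the interaction range. -/
noncomputable def unitVelocity (rate : Fin d → X → Config X d → ℝ) (κ : ℕ) : ℝ :=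
  2 * (Real.exp 1 - 1) * (2 * κ + 1) * (Fintype.card X * rMax rate + rBar rate)

lemma velocity_eq (rate : Fin d → X → Config X d → ℝ) (κ : ℕ) :
    velocity rate κ = unitVelocity rate κ * κ := by
  unfold velocity unitVelocity; ring

lemma spread_rate_le (hr : ∀ i α x, 0 ≤ rate i α x) (κ : ℕ) :
    Real.exp 1 * (2 * κ + 1) * (Fintype.card X * rMax rate) ≤ 4 / 5 * unitVelocity rate κ := by
  have h1 : 0 ≤ Fintype.card X * rMax rate := mul_nonneg (Nat.cast_nonneg _) (rMax_nonneg hr)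
  have h2 := rBar_nonneg hr
  -- Equivalent to `8 / 3 ≤ e`; the slack between `e` and `2 * (e - 1)` is the source of the `4 /
  -- 5`.
  have h3 : Real.exp 1 ≤ 8 / 5 * (Real.exp 1 - 1) := by linarith [Real.exp_one_gt_d9]
  have h4 : 0 < Real.exp 1 := Real.exp_pos 1
  calc _ ≤ 8 / 5 * (Real.exp 1 - 1) * (2 * κ + 1) *
        (Fintype.card X * rMax rate + rBar rate) := by
        have h5 : 0 ≤ 8 / 5 * (Real.exp 1 - 1) := h4.le.trans h3
        exact mul_le_mul (mul_le_mul_of_nonneg_right h3 (by positivity))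
          (le_add_of_nonneg_right h2) h1 (by positivity)
    _ = _ := by unfold unitVelocity; ring

lemma SpectralGap.unitVelocity_pos [DecidableEq X] (S : SpectralGap rate ρ lam w)
    (H : IsReversible rate ρ) (κ : ℕ) : 0 < unitVelocity rate κ := by
  have h := spread_rate_le H.rate_nonneg κ
  have h2 := S.total_rate_pos H
  have : 0 < Real.exp 1 * (2 * κ + 1) * (Fintype.card X * rMax rate) := by positivity
  linarith

/-- The profile is the distance to `{a, b}`, which vanishes at the only sites where `f` oscillates.
-/
lemma osc_transitionOp_le_of_dist [DecidableEq X] (S : SpectralGap rate ρ lam w)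
    (H : IsReversible rate ρ) (hκ0 : 0 < κ) (hκ : FiniteRange rate κ) {f : Config X d → ℝ}
    (a b : Fin d) (hf : ∀ i, i ≠ a → i ≠ b → osc i f = 0) {N : ℝ} (hN : 0 ≤ N)
    (hfN : ∀ i, osc i f ≤ N) {δ : ℝ} {i : Fin d} (ha : δ ≤ siteDist i a) (hb : δ ≤ siteDist i b)
    {t : ℝ} (ht : 0 ≤ t) :
    osc i (transitionOp rate t f) ≤ N * Real.exp (4 / 5 * unitVelocity rate κ * t - δ / κ) := by
  have h := osc_transitionOp_le S H.rate_nonneg hκ0 hκ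
    (fun i => (min (siteDist i a) (siteDist i b) : ℝ)) ?_ hN ?_ ht i (f := f)
  · refine h.trans ?_
    rw [mul_assoc, ← Real.exp_add]
    refine mul_le_mul_of_nonneg_left (Real.exp_le_exp.2 ?_) hN
    have h1 := mul_le_mul_of_nonneg_right (spread_rate_le H.rate_nonneg κ) ht
    have h2 : δ / κ ≤ (min (siteDist i a) (siteDist i b) : ℝ) / κ := by
      gcongr
      exact le_min ha hb
    linarith
  · intro i k hik
    have ha : (siteDist i a : ℝ) ≤ κ + siteDist k a := by
      exact_mod_cast (siteDist_triangle i k a).trans (Nat.add_le_add_right hik _)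
    have hb : (siteDist i b : ℝ) ≤ κ + siteDist k b := by
      exact_mod_cast (siteDist_triangle i k b).trans (Nat.add_le_add_right hik _)
    refine le_min ?_ ?_
    · linarith [min_le_left (siteDist i a : ℝ) (siteDist i b)]
    · linarith [min_le_right (siteDist i a : ℝ) (siteDist i b)]
  · intro i
    by_cases hia : i = a
    · have : (min (siteDist i a) (siteDist i b) : ℝ) = 0 := by
        rw [hia, siteDist_self, Nat.cast_zero]; exact min_eq_left (Nat.cast_nonneg _)
      rw [this, zero_div, neg_zero, Real.exp_zero, mul_one]
      exact hfN i
    by_cases hib : i = b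
    · have : (min (siteDist i a) (siteDist i b) : ℝ) = 0 := by
        rw [hib, siteDist_self, Nat.cast_zero]; exact min_eq_right (Nat.cast_nonneg _)
      rw [this, zero_div, neg_zero, Real.exp_zero, mul_one]
      exact hfN i
    rw [hf i hia hib]
    positivity

end Rates

/-- The univariate function of index `p`, as a function of the configuration. -/
def siteFun {X : Type*} {d n : ℕ} (φ : Fin d → Fin n → X → ℝ) (p : SiteIdx d n) :
    Config X d → ℝ :=
  fun x => φ p.1 p.2 (x p.1)

/-! ### Factorization of the moment matrix far from the band -/

section Clusters

variable {X : Type*} [Fintype X] {d n κ : ℕ} {rate : Fin d → X → Config X d → ℝ}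
  {ρ : Config X d → ℝ} {lam : ℕ → ℝ} {w : ℕ → Config X d → ℝ} {φ : Fin d → Fin n → X → ℝ} {C₀ : ℝ}

lemma siteFun_update (p : SiteIdx d n) {i : Fin d} (hi : i ≠ p.1) (x : Config X d) (α : X) :
    siteFun φ p (Function.update x i α) = siteFun φ p x := by
  simp [siteFun, Function.update_of_ne hi.symm]

lemma clusterFun_update (j : ClusterIdx d n) {i : Fin d} (h1 : i ≠ j.1.1) (h2 : i ≠ j.2.1)
    (x : Config X d) (α : X) :
    clusterFun φ j (Function.update x i α) = clusterFun φ j x := by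
  simp [clusterFun, Function.update_of_ne h1.symm, Function.update_of_ne h2.symm]

lemma abs_meanRho_le (H : IsReversible rate ρ) (f : Config X d → ℝ) :
    |meanRho ρ f| ≤ normRho ρ f := by
  have h := abs_innerRho_le H.density_pos f fun _ => 1
  have h1 : normRho ρ (fun _ : Config X d => 1) ≤ 1 :=
    normRho_le_of_abs_le H.density_pos H.density_sum zero_le_one fun _ => by simp
  have h2 : innerRho ρ f (fun _ => 1) = meanRho ρ f :=
    Finset.sum_congr rfl fun x _ => by rw [mul_one]
  rw [h2] at h
  exact h.trans (mul_le_of_le_one_right (normRho_nonneg _ _) h1)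

lemma sum_abs_mul_le (H : IsReversible rate ρ) (f : Config X d → ℝ) :
    ∑ x, |f x| * ρ x ≤ normRho ρ f := by
  have h := (le_abs_self _).trans (abs_meanRho_le H fun x => |f x|)
  have : normRho ρ (fun x => |f x|) = normRho ρ f := by
    simp only [normRho, innerRho, abs_mul_abs_self]
  rwa [this] at h

/-- The diagonal cluster `(p, p)` is the square of the univariate function, so bounds on clusters
control single sites. -/
lemma ClusterBound.normRho_siteFun_le (hB : ClusterBound ρ φ C₀) (H : IsReversible rate ρ)
    (p : SiteIdx d n) : normRho ρ (siteFun φ p) ≤ √C₀ := by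
  refine Real.sqrt_le_sqrt ?_
  exact ((le_abs_self _).trans (abs_meanRho_le H (clusterFun φ (p, p)))).trans (hB (p, p)).1

/-- The square has mean at most `C₀` and, as the diagonal cluster, deviates from any of its values
by at most `C₀`. -/
lemma ClusterBound.siteFun_sq_le (hB : ClusterBound ρ φ C₀) (H : IsReversible rate ρ)
    (p : SiteIdx d n) (x : Config X d) : siteFun φ p x ^ 2 ≤ 2 * C₀ := by
  have h1 : ∀ y, siteFun φ p x ^ 2 ≤ C₀ + siteFun φ p y * siteFun φ p y := by
    intro y
    have := (le_abs_self _).trans (abs_update_sub_le_osc p.1 (clusterFun φ (p, p)) y (x p.1))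
    have h2 := this.trans ((osc_le_oscNorm _ _).trans (hB (p, p)).2)
    simp only [clusterFun, Function.update_self] at h2
    simp only [siteFun]
    linarith
  have h3 := ((le_abs_self _).trans (abs_meanRho_le H (clusterFun φ (p, p)))).trans (hB (p, p)).1
  calc siteFun φ p x ^ 2 = ∑ y, siteFun φ p x ^ 2 * ρ y := by
        rw [← Finset.mul_sum, H.density_sum, mul_one]
    _ ≤ ∑ y, (C₀ + siteFun φ p y * siteFun φ p y) * ρ y := Finset.sum_le_sum fun y _ =>
        mul_le_mul_of_nonneg_right (h1 y) (H.density_pos y).le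
    _ = C₀ + meanRho ρ (clusterFun φ (p, p)) := by
        simp only [add_mul, Finset.sum_add_distrib, ← Finset.mul_sum, H.density_sum, mul_one]
        rfl
    _ ≤ 2 * C₀ := by linarith

lemma ClusterBound.osc_siteFun_le (hB : ClusterBound ρ φ C₀) (H : IsReversible rate ρ)
    (p : SiteIdx d n) (i : Fin d) : osc i (siteFun φ p) ≤ 2 * √(2 * C₀) := by
  refine osc_le (by positivity) fun x a b => ?_
  have h1 := Real.abs_le_sqrt (hB.siteFun_sq_le H p (Function.update x i a))
  have h2 := Real.abs_le_sqrt (hB.siteFun_sq_le H p (Function.update x i b))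
  linarith [(abs_le.1 h1).2, (abs_le.1 h2).1]

variable [DecidableEq X]

lemma transitionOp_zero (f : Config X d → ℝ) : transitionOp rate 0 f = f := by
  simp [transitionOp]

/-- Decay of correlations in equilibrium is the case `t = 0` of the dynamical estimate. -/
lemma ClusterBound.abs_cov_siteFun_le (hB : ClusterBound ρ φ C₀) (hC : 0 < C₀)
    (S : SpectralGap rate ρ lam w) (H : IsReversible rate ρ) (hκ0 : 0 < κ)
    (hκ : FiniteRange rate κ) {δ : ℝ} (hδ : 0 < δ) (p q : SiteIdx d n)
    (hpq : δ ≤ siteDist p.1 q.1) :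
    |meanRho ρ (clusterFun φ (p, q)) - meanRho ρ (siteFun φ p) * meanRho ρ (siteFun φ q)| ≤
      Fintype.card X * rMax rate * C₀ * (2 * (1 / lam 1) + 5 / 2 * (1 / unitVelocity rate κ)) *
        decayFactor rate κ (lam 1) δ := by
  have hR := S.total_rate_pos H
  have hV := S.unitVelocity_pos H κ
  have hs : √C₀ * √C₀ = C₀ := Real.mul_self_sqrt hC.le
  -- Here `√2 ≤ 10 / 7`, so that `7 / 8 * 2 * (10 / 7)` is the constant `5 / 2`.
  have hs2 : √(2 * C₀) * √C₀ ≤ 10 / 7 * C₀ := by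
    rw [← Real.sqrt_mul (by positivity), Real.sqrt_le_left (by positivity)]
    nlinarith
  have h := S.abs_cov_le_of_lightcone (f := siteFun φ p) (g := siteFun φ q) hκ0
    (a := 2 * (Fintype.card X * rMax rate) * C₀) (b := 20 / 7 * (Fintype.card X * rMax rate) * C₀)
    (V := unitVelocity rate κ) (δ := δ) (t := 0) (by positivity) hV hδ le_rfl ?_ ?_
  · have e : innerRho ρ (transitionOp rate 0 (siteFun φ p)) (siteFun φ q) =
        meanRho ρ (clusterFun φ (p, q)) := by rw [transitionOp_zero]; rfl
    rw [e, ← velocity_eq] at h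
    refine h.trans (le_of_eq ?_)
    unfold decayFactor
    ring
  · calc _ ≤ √C₀ * (2 * (Fintype.card X * rMax rate) * √C₀) := by
          refine mul_le_mul (hB.normRho_siteFun_le H p) ?_ (normRho_nonneg _ _) (by positivity)
          refine (H.normRho_generator_single_le (siteFun φ q) q.1
            fun i hi x α => siteFun_update q hi x α).trans ?_
          exact mul_le_mul_of_nonneg_left (hB.normRho_siteFun_le H q) (by positivity)
      _ = 2 * (Fintype.card X * rMax rate) * (√C₀ * √C₀) := by ring
      _ = _ := by rw [hs]
  · intro s hs0
    refine (H.abs_dirichlet_single_le _ (siteFun φ q) q.1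
      fun i hi x α => siteFun_update q hi x α).trans ?_
    have hpq' : δ ≤ siteDist q.1 p.1 := by rwa [siteDist_comm]
    have h1 := osc_transitionOp_le_of_dist S H hκ0 hκ (f := siteFun φ p) p.1 p.1
      (fun i hi _ => osc_eq_zero fun x a => siteFun_update p hi x a)
      (N := 2 * √(2 * C₀)) (by positivity) (fun i => hB.osc_siteFun_le H p i) hpq' hpq' hs0
    have h2 := (sum_abs_mul_le H (siteFun φ q)).trans (hB.normRho_siteFun_le H q)
    set E := Real.exp (4 / 5 * unitVelocity rate κ * s - δ / κ)
    have hE : 0 < E := Real.exp_pos _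
    calc _ ≤ Fintype.card X * rMax rate * (2 * √(2 * C₀) * E) * √C₀ := by
          refine mul_le_mul (mul_le_mul_of_nonneg_left h1 hR.le) h2
            (Finset.sum_nonneg fun x _ => mul_nonneg (abs_nonneg _) (H.density_pos x).le)
            (by positivity)
      _ = 2 * (Fintype.card X * rMax rate) * E * (√(2 * C₀) * √C₀) := by ring
      _ ≤ 2 * (Fintype.card X * rMax rate) * E * (10 / 7 * C₀) := by gcongr
      _ = _ := by ring

lemma ClusterBound.abs_cov_clusterFun_le (hB : ClusterBound ρ φ C₀) (hC : 0 < C₀)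
    (S : SpectralGap rate ρ lam w) (H : IsReversible rate ρ) (hκ0 : 0 < κ)
    (hκ : FiniteRange rate κ) {t δ : ℝ} (ht : 0 ≤ t) (hδ : 0 < δ) (i j : ClusterIdx d n)
    (hij : δ ≤ clusterDist i j) :
    |momentMatrix rate ρ φ t i j -
        meanRho ρ (clusterFun φ j) * meanRho ρ (clusterFun φ i)| ≤
      Fintype.card X * rMax rate * C₀ ^ 2 *
        (1 / lam 1 + 7 / 16 * (1 / unitVelocity rate κ)) * decayFactor rate κ (lam 1) δ := by
  have hR := S.total_rate_pos H
  have hV := S.unitVelocity_pos H κ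
  have hd : ∀ s, s = i.1.1 ∨ s = i.2.1 → δ ≤ siteDist s j.1.1 ∧ δ ≤ siteDist s j.2.1 := by
    have h1 : clusterDist i j ≤ siteDist i.1.1 j.1.1 := by unfold clusterDist; omega
    have h2 : clusterDist i j ≤ siteDist i.2.1 j.2.1 := by unfold clusterDist; omega
    have h3 : clusterDist i j ≤ siteDist i.1.1 j.2.1 := by unfold clusterDist; omega
    have h4 : clusterDist i j ≤ siteDist i.2.1 j.1.1 := by unfold clusterDist; omega
    rintro s (rfl | rfl)
    · exact ⟨hij.trans (by exact_mod_cast h1), hij.trans (by exact_mod_cast h3)⟩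
    · exact ⟨hij.trans (by exact_mod_cast h4), hij.trans (by exact_mod_cast h2)⟩
  have h := S.abs_cov_le_of_lightcone (f := clusterFun φ j) (g := clusterFun φ i) hκ0
    (a := Fintype.card X * rMax rate * C₀ ^ 2) (b := Fintype.card X * rMax rate / 2 * C₀ ^ 2)
    (V := unitVelocity rate κ) (δ := δ) (t := t) (by positivity) hV hδ ht ?_ ?_
  · rw [innerRho_comm, ← velocity_eq] at h
    refine h.trans (le_of_eq ?_)
    unfold decayFactor
    ring
  · calc _ ≤ C₀ * (Fintype.card X * rMax rate * C₀) := by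
          refine mul_le_mul (hB j).1 ?_ (normRho_nonneg _ _) hC.le
          exact (H.normRho_generator_le _).trans (mul_le_mul_of_nonneg_left (hB i).2 hR.le)
      _ = _ := by ring
  · intro s hs0
    refine (H.abs_dirichlet_le _ _).trans ?_
    set E := Real.exp (4 / 5 * unitVelocity rate κ * s - δ / κ)
    have hE : 0 < E := Real.exp_pos _
    have h1 : ∑ k, osc k (transitionOp rate s (clusterFun φ j)) * osc k (clusterFun φ i) ≤
        ∑ k, C₀ * E * osc k (clusterFun φ i) := by
      refine Finset.sum_le_sum fun k _ => ?_
      by_cases hk : k = i.1.1 ∨ k = i.2.1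
      · exact mul_le_mul_of_nonneg_right (osc_transitionOp_le_of_dist S H hκ0 hκ j.1.1 j.2.1
          (fun i h1 h2 => osc_eq_zero fun x a => clusterFun_update j h1 h2 x a) hC.le
          (fun i => (osc_le_oscNorm _ _).trans (hB j).2) (hd k hk).1 (hd k hk).2 hs0)
          (osc_nonneg _ _)
      · rw [not_or] at hk
        rw [osc_eq_zero fun x a => clusterFun_update i hk.1 hk.2 x a, mul_zero, mul_zero]
    rw [← Finset.mul_sum] at h1
    have h2 : C₀ * E * oscNorm (clusterFun φ i) ≤ C₀ * E * C₀ :=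
      mul_le_mul_of_nonneg_left (hB i).2 (by positivity)
    calc _ ≤ Fintype.card X * rMax rate / 2 * (C₀ * E * C₀) :=
          mul_le_mul_of_nonneg_left (h1.trans h2) (by positivity)
      _ = _ := by ring

lemma constC₁_nonneg (H : IsReversible rate ρ) (S : SpectralGap rate ρ lam w) (κ : ℕ) :
    0 ≤ constC₁ rate κ (lam 1) :=
  mul_nonneg (S.total_rate_pos H).le
    ((one_div_nonneg.2 S.gap.le).trans (le_max_left _ _))

lemma constC₂_nonneg (H : IsReversible rate ρ) (S : SpectralGap rate ρ lam w) (κ : ℕ) :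
    0 ≤ constC₂ rate κ (lam 1) C₀ :=
  mul_nonneg (constC₁_nonneg H S κ) ((sq_nonneg _).trans (le_max_left _ _))

lemma not_inBand {δ : ℝ} {j i : ClusterIdx d n} (h : ¬ InBand δ j i) :
    δ < clusterDist i j ∧ δ < siteDist i.1.1 i.2.1 := by
  unfold InBand at h
  rw [not_le, lt_min_iff] at h
  exact h

/-- The two sites of `i` and a site of `j` are distinct. This lets the factor `d` in the error
absorb a numerical constant. -/
lemma three_le_of_not_inBand {δ : ℝ} (hδ : 0 < δ) {j i : ClusterIdx d n} (h : ¬ InBand δ j i) :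
    3 ≤ d := by
  obtain ⟨h1, h2⟩ := not_inBand h
  have h1' : 0 < clusterDist i j := by exact_mod_cast hδ.trans h1
  have h2' : 0 < siteDist i.1.1 i.2.1 := by exact_mod_cast hδ.trans h2
  have ha := i.1.1.2
  have hb := i.2.1.2
  have hc := j.1.1.2
  unfold clusterDist at h1'
  unfold siteDist at h1' h2'
  omega

/-- Far from the band, the moment matrix factorizes up to an exponentially small error. -/
lemma ClusterBound.abs_momentMatrix_sub_le (hB : ClusterBound ρ φ C₀) (hC : 0 < C₀)
    (S : SpectralGap rate ρ lam w) (H : IsReversible rate ρ) (hκ0 : 0 < κ)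
    (hκ : FiniteRange rate κ) {t δ : ℝ} (ht : 0 ≤ t) (hδ : 0 < δ) (p q : SiteIdx d n)
    (j : ClusterIdx d n) (hij : ¬ InBand δ j (p, q)) :
    |momentMatrix rate ρ φ t (p, q) j -
        meanRho ρ (clusterFun φ j) * (meanRho ρ (siteFun φ p) * meanRho ρ (siteFun φ q))| ≤
      2 * constC₂ rate κ (lam 1) C₀ * d * decayFactor rate κ (lam 1) δ := by
  have hd : (3 : ℝ) ≤ d := by exact_mod_cast three_le_of_not_inBand hδ hij
  obtain ⟨h1, h2⟩ := not_inBand hij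
  have hA := hB.abs_cov_clusterFun_le hC S H hκ0 hκ ht hδ (p, q) j h1.le
  have hS := hB.abs_cov_siteFun_le hC S H hκ0 hκ hδ p q h2.le
  have hm := (abs_meanRho_le H (clusterFun φ j)).trans (hB j).1
  have hR := S.total_rate_pos H
  set R := Fintype.card X * rMax rate with hRdef
  set e := decayFactor rate κ (lam 1) δ
  have he : 0 < e := Real.exp_pos _
  have hκ' : (κ : ℝ) ≠ 0 := by exact_mod_cast hκ0.ne'
  have hu : κ / velocity rate κ = 1 / unitVelocity rate κ := by
    rw [velocity_eq, mul_comm, ← div_div, div_self hκ']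
  set x := max (1 / lam 1) (κ / velocity rate κ) with hx
  have hx1 : 1 / lam 1 ≤ x := le_max_left _ _
  have hx2 : 1 / unitVelocity rate κ ≤ x := hu ▸ le_max_right _ _
  have hx0 : 0 ≤ x := (one_div_nonneg.2 S.gap.le).trans hx1
  have hC₁ : constC₁ rate κ (lam 1) = R * x := rfl
  calc _ ≤ |momentMatrix rate ρ φ t (p, q) j -
            meanRho ρ (clusterFun φ j) * meanRho ρ (clusterFun φ (p, q))| +
          |meanRho ρ (clusterFun φ j)| * |meanRho ρ (clusterFun φ (p, q)) -
            meanRho ρ (siteFun φ p) * meanRho ρ (siteFun φ q)| := by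
        rw [← abs_mul, mul_sub]; exact abs_sub_le _ _ _
    -- Total constant: `23 / 16 + 9 / 2 = 95 / 16`, just below `6 = 2 * 3 ≤ 2 * d`.
    _ ≤ R * C₀ ^ 2 * (x + 7 / 16 * x) * e + C₀ * (R * C₀ * (2 * x + 5 / 2 * x) * e) := by
        refine add_le_add (hA.trans (by gcongr)) (mul_le_mul hm (hS.trans (by gcongr))
          (abs_nonneg _) hC.le)
    _ = 95 / 16 * (R * x) * C₀ ^ 2 * e := by ring
    _ ≤ 2 * 3 * (R * x) * max (C₀ ^ 2) (C₀ ^ 3) * e := by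
        gcongr
        · norm_num
        · exact le_max_left _ _
    _ ≤ 2 * d * (R * x) * max (C₀ ^ 2) (C₀ ^ 3) * e := by gcongr
    _ = _ := by unfold constC₂; rw [hC₁]; ring

end Clusters


/-! ### Counting indices inside and outside the band -/

section Counting

variable {d n : ℕ}

lemma card_siteDist_gt (a : Fin d) (m : ℕ) :
    (Finset.univ.filter fun b : Fin d => m < siteDist a b).card ≤ d - 1 - m := by
  rw [← Finset.card_range (d - 1 - m)]
  -- The sites beyond `a + m` are shifted down by `m + 1`; this fills the hole around `a` without
  -- meeting the sites on its left.
  refine Finset.card_le_card_of_injOn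
    (fun b => if (b : ℕ) < a then (b : ℕ) else (b : ℕ) - m - 1) ?_ ?_
  · intro b hb
    have hb := (Finset.mem_filter.1 hb).2
    have h1 := a.2
    have h2 := b.2
    unfold siteDist at hb
    simp only [Finset.coe_range, Set.mem_Iio]
    split_ifs <;> omega
  · intro b hb c hc h
    have hb := (Finset.mem_filter.1 hb).2
    have hc := (Finset.mem_filter.1 hc).2
    unfold siteDist at hb hc
    simp only at h
    ext
    split_ifs at h <;> omega

lemma card_filter_pairs_le (P : Fin d → Fin d → Prop) [∀ a b, Decidable (P a b)] (m : ℕ)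
    (h : ∀ a, (Finset.univ.filter fun b => P a b).card ≤ m) :
    (Finset.univ.filter fun e : Fin d × Fin d => P e.1 e.2).card ≤ d * m := by
  rw [Finset.card_filter, Fintype.sum_prod_type]
  simp only [← Finset.card_filter]
  calc _ ≤ ∑ _a : Fin d, m := Finset.sum_le_sum fun a _ => h a
    _ = d * m := by simp

lemma card_filter_sites_le (P : Fin d → Fin d → Prop) [∀ a b, Decidable (P a b)] (m : ℕ)
    (h : ∀ a, (Finset.univ.filter fun b => P a b).card ≤ m) :
    (Finset.univ.filter fun e : ClusterIdx d n => P e.1.1 e.2.1).card ≤ d * m * n ^ 2 := by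
  have h1 : (Finset.univ.filter fun e : ClusterIdx d n => P e.1.1 e.2.1).card ≤
      ((Finset.univ.filter fun e : Fin d × Fin d => P e.1 e.2) ×ˢ
        (Finset.univ : Finset (Fin n × Fin n))).card := by
    refine Finset.card_le_card_of_injOn (fun e => ((e.1.1, e.2.1), (e.1.2, e.2.2))) ?_ ?_
    · intro e he
      simpa using he
    · rintro ⟨⟨a, b⟩, ⟨c, e⟩⟩ _ ⟨⟨a', b'⟩, ⟨c', e'⟩⟩ _ h
      simp only [Prod.mk.injEq] at h ⊢
      tauto
  rw [Finset.card_product] at h1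
  refine h1.trans ?_
  simp only [Finset.card_univ, Fintype.card_prod, Fintype.card_fin, ← pow_two]
  exact Nat.mul_le_mul_right _ (card_filter_pairs_le P m h)

lemma card_sites_right_le (s : Fin d) (m : ℕ) :
    (Finset.univ.filter fun e : ClusterIdx d n => siteDist s e.2.1 ≤ m).card ≤
      d * (2 * m + 1) * n ^ 2 :=
  card_filter_sites_le (fun _ b => siteDist s b ≤ m) _ fun _ => card_siteDist_le s m

lemma card_sites_left_le (s : Fin d) (m : ℕ) :
    (Finset.univ.filter fun e : ClusterIdx d n => siteDist s e.1.1 ≤ m).card ≤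
      d * (2 * m + 1) * n ^ 2 := by
  refine le_trans (Finset.card_le_card_of_injOn Prod.swap ?_ ?_) (card_sites_right_le s m)
  · intro e he
    simpa using he
  · exact Prod.swap_injective.injOn

lemma card_sites_close_le (m : ℕ) :
    (Finset.univ.filter fun e : ClusterIdx d n => siteDist e.1.1 e.2.1 ≤ m).card ≤
      d * (2 * m + 1) * n ^ 2 :=
  card_filter_sites_le (fun a b => siteDist a b ≤ m) _ fun a => card_siteDist_le a m

open Finset in
lemma ncard_inBand_le {δ : ℝ} (hδ : 0 < δ) (j : ClusterIdx d n) :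
    {e : ClusterIdx d n | InBand δ j e}.ncard ≤ 15 * (n ^ 2 * d * ⌈δ⌉₊) := by
  set m := ⌊δ⌋₊ with hm
  -- The band is covered by five strips, one for each distance in the minimum. Each has at most `d *
  -- (2 * m + 1) * n ^ 2` elements and `2 * m + 1 ≤ 3 * ⌈δ⌉₊`, whence `15`.
  have hsub : {e : ClusterIdx d n | InBand δ j e} ⊆
      (((univ.filter fun e : ClusterIdx d n => siteDist j.1.1 e.1.1 ≤ m) ∪
        (univ.filter fun e : ClusterIdx d n => siteDist j.2.1 e.2.1 ≤ m) ∪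
        (univ.filter fun e : ClusterIdx d n => siteDist j.2.1 e.1.1 ≤ m) ∪
        (univ.filter fun e : ClusterIdx d n => siteDist j.1.1 e.2.1 ≤ m) ∪
        (univ.filter fun e : ClusterIdx d n => siteDist e.1.1 e.2.1 ≤ m) : Finset _) :
          Set (ClusterIdx d n)) := by
    intro e he
    change (min (clusterDist e j) (siteDist e.1.1 e.2.1) : ℝ) ≤ δ at he
    rw [← Nat.cast_min, ← Nat.le_floor_iff hδ.le, ← hm] at he
    simp only [coe_union, coe_filter, mem_univ, true_and, Set.mem_union, Set.mem_ofPred_eq]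
    unfold clusterDist at he
    rw [siteDist_comm j.1.1, siteDist_comm j.2.1, siteDist_comm j.2.1, siteDist_comm j.1.1]
    omega
  refine (Set.ncard_le_ncard hsub (Finset.finite_toSet _)).trans ?_
  rw [Set.ncard_coe_finset]
  have h1 := card_sites_left_le (n := n) j.1.1 m
  have h2 := card_sites_right_le (n := n) j.2.1 m
  have h3 := card_sites_left_le (n := n) j.2.1 m
  have h4 := card_sites_right_le (n := n) j.1.1 m
  have h5 := card_sites_close_le (d := d) (n := n) m
  have hc : 2 * m + 1 ≤ 3 * ⌈δ⌉₊ := by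
    have h6 : m ≤ ⌈δ⌉₊ := Nat.floor_le_ceil δ
    have h7 : 0 < ⌈δ⌉₊ := Nat.ceil_pos.2 hδ
    omega
  have h8 : d * (2 * m + 1) * n ^ 2 ≤ d * (3 * ⌈δ⌉₊) * n ^ 2 := by gcongr
  have h9 : 15 * (n ^ 2 * d * ⌈δ⌉₊) = 5 * (d * (3 * ⌈δ⌉₊) * n ^ 2) := by ring
  rw [h9]
  refine (card_union_le _ _).trans ?_
  have k1 := card_union_le
    ((univ.filter fun e : ClusterIdx d n => siteDist j.1.1 e.1.1 ≤ m) ∪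
        (univ.filter fun e : ClusterIdx d n => siteDist j.2.1 e.2.1 ≤ m) ∪
        (univ.filter fun e : ClusterIdx d n => siteDist j.2.1 e.1.1 ≤ m))
    (univ.filter fun e : ClusterIdx d n => siteDist j.1.1 e.2.1 ≤ m)
  have k2 := card_union_le
    ((univ.filter fun e : ClusterIdx d n => siteDist j.1.1 e.1.1 ≤ m) ∪
        (univ.filter fun e : ClusterIdx d n => siteDist j.2.1 e.2.1 ≤ m))
    (univ.filter fun e : ClusterIdx d n => siteDist j.2.1 e.1.1 ≤ m)
  have k3 := card_union_le
    (univ.filter fun e : ClusterIdx d n => siteDist j.1.1 e.1.1 ≤ m)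
    (univ.filter fun e : ClusterIdx d n => siteDist j.2.1 e.2.1 ≤ m)
  omega

open Finset Classical in
lemma card_not_inBand_le {δ : ℝ} (hδ : 0 < δ) (j : ClusterIdx d n) :
    ((univ.filter fun e : ClusterIdx d n => ¬ InBand δ j e).card : ℝ) ≤
      n ^ 2 * (d * max (d - δ) 0) := by
  set m := ⌊δ⌋₊ with hm
  have h1 : (univ.filter fun e : ClusterIdx d n => ¬ InBand δ j e).card ≤
      (univ.filter fun e : ClusterIdx d n => m < siteDist e.1.1 e.2.1).card := by
    refine card_le_card fun e he => ?_
    have := (not_inBand (mem_filter.1 he).2).2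
    rw [mem_filter]
    exact ⟨mem_univ _, (Nat.floor_lt hδ.le).2 this⟩
  have h2 : (univ.filter fun e : ClusterIdx d n => m < siteDist e.1.1 e.2.1).card ≤
      d * (d - 1 - m) * n ^ 2 :=
    card_filter_sites_le (fun a b => m < siteDist a b) _ fun a => card_siteDist_gt a m
  have h3 : ((d - 1 - m : ℕ) : ℝ) ≤ max (d - δ) 0 := by
    rcases Nat.lt_or_ge d (1 + m) with h | h
    · have : d - 1 - m = 0 := by omega
      rw [this, Nat.cast_zero]
      exact le_max_right _ _
    · rw [Nat.sub_sub, Nat.cast_sub h]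
      refine le_trans ?_ (le_max_left _ _)
      have := Nat.lt_floor_add_one δ
      push_cast
      linarith
  calc ((univ.filter fun e : ClusterIdx d n => ¬ InBand δ j e).card : ℝ)
      ≤ (d * (d - 1 - m) * n ^ 2 : ℕ) := by exact_mod_cast h1.trans h2
    _ = n ^ 2 * (d * ((d - 1 - m : ℕ) : ℝ)) := by push_cast; ring
    _ ≤ _ := by gcongr

end Counting

/-! ### Sparse plus rank-one columns -/

section Columns

variable {X : Type*} [Fintype X] [DecidableEq X] {d n κ : ℕ}
  {rate : Fin d → X → Config X d → ℝ} {ρ : Config X d → ℝ} {lam : ℕ → ℝ}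
  {w : ℕ → Config X d → ℝ} {φ : Fin d → Fin n → X → ℝ} {C₀ : ℝ}

open Classical in
/-- Every column of the moment matrix is close to a sparse matrix plus one of rank one. -/
lemma ClusterBound.exists_column_approx (hB : ClusterBound ρ φ C₀) (hC : 0 < C₀)
    (S : SpectralGap rate ρ lam w) (H : IsReversible rate ρ) (hκ0 : 0 < κ)
    (hκ : FiniteRange rate κ) {t δ : ℝ} (ht : 0 ≤ t) (hδ : 0 < δ) (j : ClusterIdx d n) :
    ∃ c : ClusterIdx d n → ℝ, (∃ S W : Matrix (SiteIdx d n) (SiteIdx d n) ℝ,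
      (∀ p q, c (p, q) = S p q + W p q) ∧ W.rank ≤ 1 ∧
      (∀ p q, InBand δ j (p, q) → S p q = momentMatrix rate ρ φ t (p, q) j - W p q) ∧
      (∀ p q, ¬ InBand δ j (p, q) → S p q = 0) ∧
      {e : SiteIdx d n × SiteIdx d n | S e.1 e.2 ≠ 0}.ncard ≤ 15 * (n ^ 2 * d * ⌈δ⌉₊)) ∧
      ‖WithLp.toLp 2 (fun i => momentMatrix rate ρ φ t i j - c i)‖ ≤
        2 * constC₂ rate κ (lam 1) C₀ * (n * d) * Real.sqrt (d * max (d - δ) 0) *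
          decayFactor rate κ (lam 1) δ := by
  set M := momentMatrix rate ρ φ t with hM
  let W : Matrix (SiteIdx d n) (SiteIdx d n) ℝ := Matrix.vecMulVec
    (fun p => meanRho ρ (clusterFun φ j) * meanRho ρ (siteFun φ p))
    (fun q => meanRho ρ (siteFun φ q))
  let Sp : Matrix (SiteIdx d n) (SiteIdx d n) ℝ := Matrix.of fun p q =>
    if InBand δ j (p, q) then M (p, q) j - W p q else 0
  refine ⟨fun i => Sp i.1 i.2 + W i.1 i.2, ⟨Sp, W, fun p q => rfl, Matrix.rank_vecMulVec_le _ _,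
    fun p q h => if_pos h, fun p q h => if_neg h, ?_⟩, ?_⟩
  · refine le_trans (Set.ncard_le_ncard ?_ (Set.toFinite _)) (ncard_inBand_le hδ j)
    intro e he
    by_contra h
    exact he (if_neg h)
  · set ε := 2 * constC₂ rate κ (lam 1) C₀ * d * decayFactor rate κ (lam 1) δ with hε
    have hε0 : 0 ≤ ε := by
      have := constC₂_nonneg (C₀ := C₀) H S κ
      have := Real.exp_pos (-(lam 1 * δ / (velocity rate κ + lam 1 * κ)))
      rw [hε, decayFactor]
      positivity
    have hterm : ∀ i : ClusterIdx d n, (M i j - (Sp i.1 i.2 + W i.1 i.2)) ^ 2 ≤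
        if ¬ InBand δ j i then ε ^ 2 else 0 := by
      rintro ⟨p, q⟩
      by_cases h : InBand δ j (p, q)
      · have : Sp p q = M (p, q) j - W p q := if_pos h
        simp [this, h]
      · have h0 : Sp p q = 0 := if_neg h
        rw [if_pos h]
        refine sq_le_sq.2 (le_trans ?_ (le_abs_self ε))
        have := hB.abs_momentMatrix_sub_le hC S H hκ0 hκ ht hδ p q j h
        rw [← mul_assoc] at this
        rwa [h0, zero_add]
    rw [EuclideanSpace.norm_eq]
    simp only [Real.norm_eq_abs, sq_abs]
    refine Real.sqrt_le_iff.2 ⟨?_, ?_⟩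
    · have := constC₂_nonneg (C₀ := C₀) H S κ
      have := Real.exp_pos (-(lam 1 * δ / (velocity rate κ + lam 1 * κ)))
      rw [decayFactor]
      positivity
    · refine (Finset.sum_le_sum fun i _ => hterm i).trans ?_
      rw [← Finset.sum_filter, Finset.sum_const, nsmul_eq_mul]
      refine (mul_le_mul_of_nonneg_right (card_not_inBand_le hδ j) (sq_nonneg ε)).trans
        (le_of_eq ?_)
      have hs : √(d * max (d - δ) 0) ^ 2 = d * max (d - δ) 0 :=
        Real.sq_sqrt (mul_nonneg (Nat.cast_nonneg _) (le_max_right _ _))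
      rw [hε]
      simp only [mul_pow, hs]
      ring

end Columns


/-! ### Selection of maximal volume -/

section MaxVolume

open Module in
lemma Module.Basis.det_update_sum {V κ : Type*} [AddCommGroup V] [Module ℝ V] [Fintype κ]
    [DecidableEq κ] (b : Basis κ ℝ V) (v : κ → V) (c : κ → ℝ) (k : κ) :
    b.det (Function.update v k (∑ l, c l • v l)) = c k * b.det v := by
  rw [AlternatingMap.map_update_sum, Finset.sum_eq_single k]
  · rw [AlternatingMap.map_update_smul, Function.update_eq_self, smul_eq_mul]
  · intro l _ hl
    rw [AlternatingMap.map_update_smul, AlternatingMap.map_update_self _ _ hl.symm, smul_zero]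
  · simp

open Module in
/-- In a finite spanning family there is a basis of maximal volume, in which all members of the
family have coefficients bounded by one. -/
lemma exists_maxVolume_basis {ι V : Type*} [Finite ι] [AddCommGroup V] [Module ℝ V]
    [FiniteDimensional ℝ V] (v : ι → V) (hv : ⊤ ≤ Submodule.span ℝ (Set.range v)) :
    ∃ J : Fin (finrank ℝ V) ↪ ι, ∃ T : Fin (finrank ℝ V) → ι → ℝ,
      (∀ i, v i = ∑ k, T k i • v (J k)) ∧ ∀ k i, |T k i| ≤ 1 := by
  classical
  let b := finBasis ℝ V
  obtain ⟨κ, a, -, hspan, hli⟩ := exists_linearIndependent' ℝ v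
  let b₀ : Basis κ ℝ V := Basis.mk hli (by rw [hspan]; exact hv)
  have : Fintype κ := FiniteDimensional.fintypeBasisIndex b₀
  let e : κ ≃ Fin (finrank ℝ V) := Fintype.equivFinOfCardEq (finrank_eq_card_basis b₀).symm
  have h₀ : b.det (v ∘ (a ∘ e.symm)) ≠ 0 := by
    have h := (b.isUnit_det (b₀.reindex e)).ne_zero
    have h' : (b₀.reindex e : Fin (finrank ℝ V) → V) = v ∘ (a ∘ e.symm) := by
      funext k
      simp [b₀]
    rwa [h'] at h
  have : Nonempty (Fin (finrank ℝ V) → ι) := ⟨a ∘ e.symm⟩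
  obtain ⟨J, hJ⟩ := Finite.exists_max fun J : Fin (finrank ℝ V) → ι => |b.det (v ∘ J)|
  have hJ0 : b.det (v ∘ J) ≠ 0 := abs_pos.1 ((abs_pos.2 h₀).trans_le (hJ _))
  obtain ⟨hJli, hJspan⟩ := b.is_basis_iff_det.2 (isUnit_iff_ne_zero.2 hJ0)
  let b' : Basis (Fin (finrank ℝ V)) ℝ V := Basis.mk hJli hJspan.ge
  have hT : ∀ i, v i = ∑ k, b'.repr (v i) k • v (J k) := fun i => by
    conv_lhs => rw [← b'.sum_repr (v i)]
    simp [b']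
  refine ⟨⟨J, hJli.injective.of_comp⟩, fun k i => b'.repr (v i) k, hT, fun k i => ?_⟩
  -- Cramer's rule: exchanging the `k`-th basis vector for `v i` multiplies the determinant by the
  -- `k`-th coefficient of `v i`, which maximality bounds by one.
  have h := hJ (Function.update J k i)
  have h1 : v ∘ Function.update J k i = Function.update (v ∘ J) k (v i) :=
    Function.comp_update v J k i
  have h2 := b.det_update_sum (v ∘ J) (fun l => b'.repr (v i) l) k
  simp only [Function.comp_apply] at h2
  rw [← hT i] at h2
  simp only [h1, h2] at h
  rw [abs_mul] at h
  exact le_of_mul_le_mul_right (by rwa [one_mul]) (abs_pos.2 hJ0)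

open Module in
/-- Any finite family of at least `r` vectors in `ℝ ^ r` has `r` members that generate the whole
family with coefficients bounded by one. -/
lemma exists_embedding_bounded_coeff {ι : Type*} [Fintype ι] [DecidableEq ι] {r : ℕ}
    (hr : r ≤ Fintype.card ι) (v : ι → Fin r → ℝ) :
    ∃ (J : Fin r ↪ ι) (T : Matrix (Fin r) ι ℝ),
      (∀ i k, v i k = ∑ l, T l i * v (J l) k) ∧ ∀ l i, |T l i| ≤ 1 := by
  let V := Submodule.span ℝ (Set.range v)
  let v' : ι → V := fun i => ⟨v i, Submodule.subset_span ⟨i, rfl⟩⟩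
  have hv' : ⊤ ≤ Submodule.span ℝ (Set.range v') := by
    rw [← Submodule.map_le_map_iff_of_injective V.injective_subtype, Submodule.map_span,
      ← Set.range_comp, Submodule.map_top, Submodule.range_subtype]
    exact le_rfl
  obtain ⟨J, T, hT, hT1⟩ := exists_maxVolume_basis v' hv'
  have hs : finrank ℝ V ≤ r := by simpa using V.finrank_le
  let A : Finset ι := Finset.univ.map J
  have hA : A.card = finrank ℝ V := by simp [A]
  -- The family may span less than `ℝ ^ r`: the selection is padded to `r` indices, the added ones
  -- receiving zero coefficients.
  obtain ⟨B, hAB, -, hB⟩ := Finset.exists_subsuperset_card_eq (Finset.subset_univ A)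
    (hA.le.trans hs) (by rwa [Finset.card_univ])
  let e : B ≃ Fin r := Finset.equivFinOfCardEq hB
  let T' : ι → ι → ℝ := fun j i => if h : ∃ k, J k = j then T h.choose i else 0
  have hT'J : ∀ k i, T' (J k) i = T k i := fun k i => by
    have h : ∃ l, J l = J k := ⟨k, rfl⟩
    simp only [T', dif_pos h]
    rw [J.injective h.choose_spec]
  refine ⟨e.symm.toEmbedding.trans (Function.Embedding.subtype _),
    Matrix.of fun l i => T' (e.symm l) i, fun i k => ?_, fun l i => ?_⟩
  · have h1 : ∑ l, T' (e.symm l : ι) i * v (e.symm l : ι) k = ∑ j ∈ B, T' j i * v j k := by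
      rw [Equiv.sum_comp e.symm fun j : B => T' (j : ι) i * v (j : ι) k]
      exact Finset.sum_coe_sort B fun j => T' j i * v j k
    have h2 : ∑ j ∈ B, T' j i * v j k = ∑ j ∈ A, T' j i * v j k := by
      refine (Finset.sum_subset hAB fun j _ hj => ?_).symm
      have : ¬ ∃ k, J k = j := fun ⟨k, hk⟩ => hj (by simp [A, ← hk])
      simp [T', dif_neg this]
    have h3 := congrArg (fun u : V => (u : Fin r → ℝ) k) (hT i)
    simp only [v', Submodule.coe_sum, Submodule.coe_smul, Finset.sum_apply, Pi.smul_apply,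
      smul_eq_mul] at h3
    refine h3.trans (Eq.symm (h1.trans (h2.trans ?_)))
    rw [Finset.sum_map]
    exact Finset.sum_congr rfl fun k' _ => by rw [hT'J]
  · simp only [Matrix.of_apply, T']
    split_ifs with h
    · exact hT1 _ _
    · simp

end MaxVolume

/-! ### Matrix norms, singular values and symmetric cross approximation -/

section Norms

open scoped Matrix.Norms.Frobenius

variable {ι κ : Type*} [Fintype ι] [Fintype κ]

lemma Matrix.frobenius_norm_eq_sqrt (A : Matrix ι κ ℝ) : ‖A‖ = √(∑ i, ∑ j, A i j ^ 2) := by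
  rw [Matrix.frobenius_norm_def, Real.sqrt_eq_rpow]
  simp

lemma Matrix.frobenius_norm_le_of_entry (A : Matrix ι κ ℝ) {B : ℝ} (hB : 0 ≤ B)
    (h : ∀ i j, |A i j| ≤ B) : ‖A‖ ≤ √(Fintype.card ι * Fintype.card κ) * B := by
  rw [Matrix.frobenius_norm_eq_sqrt, Real.sqrt_le_left (by positivity), mul_pow,
    Real.sq_sqrt (by positivity)]
  calc _ ≤ ∑ _i : ι, ∑ _j : κ, B ^ 2 := Finset.sum_le_sum fun i _ => Finset.sum_le_sum fun j _ =>
        sq_le_sq.2 ((h i j).trans (le_abs_self B))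
    _ = _ := by simp [mul_assoc]

lemma Matrix.frobenius_norm_le_of_column (A : Matrix ι κ ℝ) {B : ℝ} (hB : 0 ≤ B)
    (h : ∀ j, ‖WithLp.toLp 2 (fun i => A i j)‖ ≤ B) : ‖A‖ ≤ √(Fintype.card κ) * B := by
  rw [Matrix.frobenius_norm_eq_sqrt, Real.sqrt_le_left (by positivity), mul_pow,
    Real.sq_sqrt (by positivity), Finset.sum_comm]
  calc _ ≤ ∑ _j : κ, B ^ 2 := Finset.sum_le_sum fun j _ => by
        have h1 := h j
        rw [EuclideanSpace.norm_eq, Real.sqrt_le_left hB] at h1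
        simpa using h1
    _ = _ := by simp

variable [DecidableEq ι]

lemma specNorm_nonneg (A : Matrix ι ι ℝ) : 0 ≤ specNorm A := norm_nonneg _

lemma specNorm_add_le (A B : Matrix ι ι ℝ) : specNorm (A + B) ≤ specNorm A + specNorm B := by
  unfold specNorm
  rw [map_add]
  exact norm_add_le _ _

lemma specNorm_mul_le (A B : Matrix ι ι ℝ) : specNorm (A * B) ≤ specNorm A * specNorm B := by
  unfold specNorm
  rw [map_mul]
  exact norm_mul_le _ _

lemma specNorm_transpose (A : Matrix ι ι ℝ) : specNorm A.transpose = specNorm A := by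
  have h : A.transpose = star A := by
    rw [Matrix.star_eq_conjTranspose, Matrix.conjTranspose_eq_transpose_of_trivial]
  unfold specNorm
  rw [h, map_star]
  exact (ContinuousLinearMap.adjoint (𝕜 := ℝ)).norm_map _

lemma specNorm_le_frobenius (A : Matrix ι ι ℝ) : specNorm A ≤ ‖A‖ := by
  refine ContinuousLinearMap.opNorm_le_bound _ (norm_nonneg _) fun x => ?_
  have hS : 0 ≤ ∑ i, ∑ j, A i j ^ 2 :=
    Finset.sum_nonneg fun i _ => Finset.sum_nonneg fun j _ => sq_nonneg _
  rw [Matrix.frobenius_norm_eq_sqrt, EuclideanSpace.norm_eq, EuclideanSpace.norm_eq]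
  refine le_trans (Real.sqrt_le_sqrt ?_) (Real.sqrt_mul hS _).le
  rw [Finset.sum_mul]
  refine Finset.sum_le_sum fun i _ => ?_
  have h := Finset.sum_mul_sq_le_sq_mul_sq Finset.univ (fun j => A i j) (fun j => x j)
  simpa [Matrix.mulVec, dotProduct] using h

/-- On a unit eigenvector of the adjoint of `A` times `A`, the length of the image is the singular
value; indices beyond the dimension give zero. -/
lemma sigma_le_specNorm (A : Matrix ι ι ℝ) (k : ℕ) : sigma k A ≤ specNorm A := by
  unfold sigma
  set T := Matrix.toEuclideanLin A with hT
  have happ : ∀ x, T x = Matrix.toEuclideanCLM (n := ι) (𝕜 := ℝ) A x := fun x => rfl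
  rcases Nat.lt_or_ge (k - 1) (Module.finrank ℝ (EuclideanSpace ℝ ι)) with h | h
  · obtain ⟨x, hx⟩ := (T.hasEigenvalue_adjoint_comp_self_sq_singularValues h).exists_hasEigenvector
    have hx0 : 0 < ‖x‖ := norm_pos_iff.2 hx.2
    have h1 : inner ℝ (T x) (T x) = T.singularValues (k - 1) ^ 2 * ‖x‖ ^ 2 := by
      rw [← LinearMap.adjoint_inner_left, ← LinearMap.comp_apply, hx.apply_eq_smul,
        inner_smul_left, real_inner_self_eq_norm_sq]
      simp
    rw [real_inner_self_eq_norm_sq, ← mul_pow] at h1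
    have h2 : ‖T x‖ = T.singularValues (k - 1) * ‖x‖ :=
      (sq_eq_sq₀ (norm_nonneg _)
        (mul_nonneg (T.singularValues_nonneg _) (norm_nonneg _))).1 h1
    have h3 : ‖T x‖ ≤ specNorm A * ‖x‖ := by
      rw [happ]; exact ContinuousLinearMap.le_opNorm _ x
    rw [h2] at h3
    exact le_of_mul_le_mul_right h3 hx0
  · rw [T.singularValues_of_finrank_le h]
    exact specNorm_nonneg A

lemma sigma_anti (A : Matrix ι ι ℝ) {k l : ℕ} (h : k ≤ l) : sigma l A ≤ sigma k A :=
  (Matrix.toEuclideanLin A).singularValues_antitone (Nat.sub_le_sub_right h 1)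

lemma lt_rank_of_sigma_pos (A : Matrix ι ι ℝ) {r : ℕ} (h : 0 < sigma (r + 1) A) : r < A.rank := by
  rw [sigma, Nat.add_sub_cancel, LinearMap.singularValues_pos_iff_lt_finrank_range] at h
  rwa [Matrix.rank_eq_finrank_range_toLin A (EuclideanSpace.basisFun ι ℝ).toBasis
    (EuclideanSpace.basisFun ι ℝ).toBasis, ← Matrix.toEuclideanLin_eq_toLin_orthonormal]

variable [DecidableEq κ]

/-- A symmetric matrix whose columns are nearly spanned by those of `C` is nearly of the form
`C U Cᵀ`. -/
lemma exists_symmetric_cross_approx (M : Matrix ι ι ℝ) (hM : M.transpose = M) (C : Matrix ι κ ℝ)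
    (T : Matrix κ ι ℝ) :
    ∃ U : Matrix κ κ ℝ, specNorm (M - C * U * C.transpose) ≤ 2 * specNorm (M - C * T) := by
  let Φ := Matrix.toEuclideanCLM (n := ι) (𝕜 := ℝ)
  let K : Submodule ℝ (EuclideanSpace ℝ ι) := (Matrix.toEuclideanLin C).range
  let P : Matrix ι ι ℝ := Φ.symm K.starProjection
  have hΦP : Φ P = K.starProjection := Φ.apply_symm_apply _
  have hPt : P.transpose = P := by
    rw [← Matrix.conjTranspose_eq_transpose_of_trivial, ← Matrix.star_eq_conjTranspose]
    have h : Φ (star P) = Φ P := by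
      rw [map_star, hΦP]
      exact isSelfAdjoint_starProjection K
    exact EquivLike.injective Φ h
  have hY : ∀ i, ∃ y : EuclideanSpace ℝ κ,
      Matrix.toEuclideanLin C y = Φ P (EuclideanSpace.single i 1) := fun i => by
    rw [hΦP]
    exact K.starProjection_apply_mem _
  choose y hy using hY
  let Y : Matrix κ ι ℝ := Matrix.of fun k i => y i k
  have hPY : P = C * Y := by
    ext a i
    have h := congrArg (fun u : EuclideanSpace ℝ ι => u a) (hy i)
    have h1 : (Φ P (EuclideanSpace.single i 1)) a = P a i := by
      simp [Φ]
    have h2 : (Matrix.toEuclideanLin C (y i)) a = (C * Y) a i := by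
      simp [Matrix.mul_apply, Matrix.mulVec, dotProduct, Y]
    rw [← h1, ← h2]
    exact h.symm
  have hPC : P * C = C := by
    ext a k
    have hmem : Matrix.toEuclideanLin C (EuclideanSpace.single k 1) ∈ K := ⟨_, rfl⟩
    have h := K.starProjection_eq_self_iff.2 hmem
    rw [← hΦP] at h
    have h1 := congrArg (fun u : EuclideanSpace ℝ ι => u a) h
    have h2 : (Matrix.toEuclideanLin C (EuclideanSpace.single k 1)) a = C a k := by
      simp
    simp only [h2] at h1
    rw [← h1]
    simp [Φ, Matrix.mul_apply, Matrix.mulVec, dotProduct, Pi.single_apply]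
  have hP1 : specNorm P ≤ 1 := by
    change ‖Φ P‖ ≤ 1
    rw [hΦP]
    exact K.starProjection_norm_le
  have hQ1 : specNorm (1 - P) ≤ 1 := by
    change ‖Φ (1 - P)‖ ≤ 1
    rw [map_sub, map_one, hΦP]
    have : (1 : EuclideanSpace ℝ ι →L[ℝ] EuclideanSpace ℝ ι) - K.starProjection =
        Kᗮ.starProjection := by
      rw [Submodule.starProjection_orthogonal]; rfl
    rw [this]
    exact Kᗮ.starProjection_norm_le
  -- `1 - P` annihilates the columns of `C`, so `C * T` may be subtracted freely.
  have hres : specNorm ((1 - P) * M) ≤ specNorm (M - C * T) := by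
    have : (1 - P) * M = (1 - P) * (M - C * T) := by
      rw [Matrix.mul_sub, ← Matrix.mul_assoc, Matrix.sub_mul 1 P C, hPC, Matrix.one_mul, sub_self,
        Matrix.zero_mul, sub_zero]
    rw [this]
    exact (specNorm_mul_le _ _).trans (mul_le_of_le_one_left (specNorm_nonneg _) hQ1)
  have hres' : specNorm (M * (1 - P)) ≤ specNorm (M - C * T) := by
    rwa [← specNorm_transpose, Matrix.transpose_mul, Matrix.transpose_sub, Matrix.transpose_one,
      hPt, hM]
  -- Since `P = C * Y` is symmetric, this choice makes `C * U * C.transpose` equal to `P * M * P`.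
  refine ⟨Y * M * Y.transpose, ?_⟩
  have hdecomp : M - C * (Y * M * Y.transpose) * C.transpose =
      (1 - P) * M + P * (M * (1 - P)) := by
    have : C * (Y * M * Y.transpose) * C.transpose = P * M * P := by
      nth_rewrite 2 [← hPt]
      rw [hPY, Matrix.transpose_mul]
      simp only [Matrix.mul_assoc]
    rw [this]
    noncomm_ring
  rw [hdecomp]
  refine (specNorm_add_le _ _).trans ?_
  have := (specNorm_mul_le P (M * (1 - P))).trans (mul_le_of_le_one_left (specNorm_nonneg _) hP1)
  linarith

end Norms


/-! ### Low-rank structure of the moment matrix -/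

section MomentMatrix

variable {X : Type*} [Fintype X] [DecidableEq X] {d n κ : ℕ}
  {rate : Fin d → X → Config X d → ℝ} {ρ : Config X d → ℝ} {lam : ℕ → ℝ}
  {w : ℕ → Config X d → ℝ} {φ : Fin d → Fin n → X → ℝ} {C₀ : ℝ}

open Finset in
lemma SpectralGap.momentMatrix_apply (S : SpectralGap rate ρ lam w) (t : ℝ)
    (i j : ClusterIdx d n) :
    momentMatrix rate ρ φ t i j = ∑ k ∈ range (Fintype.card (Config X d)),
      Real.exp (-(lam k * t)) *
        (innerRho ρ (clusterFun φ i) (w k) * innerRho ρ (clusterFun φ j) (w k)) := by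
  rw [momentMatrix, Matrix.of_apply, innerRho_comm, S.innerRho_transitionOp]
  exact Finset.sum_congr rfl fun k _ => by ring

lemma SpectralGap.momentMatrix_transpose (S : SpectralGap rate ρ lam w) (t : ℝ) :
    (momentMatrix rate ρ φ t).transpose = momentMatrix rate ρ φ t := by
  ext i j
  rw [Matrix.transpose_apply, S.momentMatrix_apply, S.momentMatrix_apply]
  exact Finset.sum_congr rfl fun k _ => by ring

/-- `M` factors through the functions on `Ω`. A positive `σ_{r+1}` thus forces `r < |Ω|`, where `lam
r` is a genuine eigenvalue. -/
lemma rank_momentMatrix_le (t : ℝ) :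
    (momentMatrix rate ρ φ t).rank ≤ Fintype.card (Config X d) := by
  have h : momentMatrix rate ρ φ t =
      (Matrix.of fun i x => clusterFun φ i x : Matrix (ClusterIdx d n) (Config X d) ℝ) *
        (Matrix.of fun x j => transitionOp rate t (clusterFun φ j) x * ρ x) := by
    ext i j
    rw [Matrix.mul_apply]
    exact Finset.sum_congr rfl fun x _ => by simp [mul_assoc]
  rw [h]
  exact (Matrix.rank_mul_le_left _ _).trans (Matrix.rank_le_card_width _)

open Finset in
/-- The contribution of the fast modes to the moment matrix. -/
lemma ClusterBound.abs_sum_fast_le (hB : ClusterBound ρ φ C₀) (hC : 0 < C₀)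
    (S : SpectralGap rate ρ lam w) {t : ℝ} (ht : 0 ≤ t) (r : ℕ) (i j : ClusterIdx d n) :
    |∑ k ∈ Ico r (Fintype.card (Config X d)), Real.exp (-(lam k * t)) *
        (innerRho ρ (clusterFun φ i) (w k) * innerRho ρ (clusterFun φ j) (w k))| ≤
      C₀ ^ 2 * Real.exp (-(lam r * t)) := by
  calc _ ≤ ∑ k ∈ Ico r (Fintype.card (Config X d)), Real.exp (-(lam r * t)) *
        (|innerRho ρ (clusterFun φ i) (w k)| * |innerRho ρ (clusterFun φ j) (w k)|) := by
        refine (Finset.abs_sum_le_sum_abs _ _).trans (Finset.sum_le_sum fun k hk => ?_)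
        rw [mem_Ico] at hk
        rw [abs_mul, abs_mul, abs_of_pos (Real.exp_pos _)]
        refine mul_le_mul_of_nonneg_right (Real.exp_le_exp.2 (neg_le_neg ?_)) (by positivity)
        exact mul_le_mul_of_nonneg_right (S.mono r k hk.1 hk.2) ht
    _ ≤ Real.exp (-(lam r * t)) * (C₀ * C₀) := by
        rw [← Finset.mul_sum]
        refine mul_le_mul_of_nonneg_left ?_ (Real.exp_pos _).le
        refine le_trans (Finset.sum_le_sum_of_subset_of_nonneg (t := range _) (fun k hk =>
          mem_range.2 (mem_Ico.1 hk).2) fun _ _ _ => by positivity)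
          ((S.sum_abs_coeff_le _ _).trans ?_)
        exact mul_le_mul (hB i).1 (hB j).1 (normRho_nonneg _ _) hC.le
    _ = _ := by ring

/-- Column selection for the slow modes: the selected columns reproduce the moment matrix up to
the fast modes, with bounded coefficients. -/
lemma ClusterBound.exists_column_selection (hB : ClusterBound ρ φ C₀) (hC : 0 < C₀)
    (S : SpectralGap rate ρ lam w) {t : ℝ} (ht : 0 ≤ t) {r : ℕ} (hr : r ≤ (d * n) ^ 2) :
    ∃ (J : Fin r ↪ ClusterIdx d n) (T : Matrix (Fin r) (ClusterIdx d n) ℝ),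
      (∀ l i, |T l i| ≤ 1) ∧ (r ≤ Fintype.card (Config X d) → ∀ i j,
        |(momentMatrix rate ρ φ t - (momentMatrix rate ρ φ t).submatrix id J * T) i j| ≤
          (1 + r) * (C₀ ^ 2 * Real.exp (-(lam r * t)))) := by
  have hcard : r ≤ Fintype.card (ClusterIdx d n) := by
    simpa [pow_two] using hr
  obtain ⟨J, T, hT, hT1⟩ := exists_embedding_bounded_coeff hcard
    fun i (k : Fin r) => innerRho ρ (clusterFun φ i) (w k)
  refine ⟨J, T, hT1, fun hrN i j => ?_⟩
  let g : ClusterIdx d n → ClusterIdx d n → ℕ → ℝ := fun i j k => Real.exp (-(lam k * t)) *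
    (innerRho ρ (clusterFun φ i) (w k) * innerRho ρ (clusterFun φ j) (w k))
  let Q : ClusterIdx d n → ClusterIdx d n → ℝ := fun i j =>
    ∑ k ∈ Finset.Ico r (Fintype.card (Config X d)), g i j k
  have hsplit : ∀ i j, momentMatrix rate ρ φ t i j = ∑ k : Fin r, g i j k + Q i j := fun i j => by
    rw [S.momentMatrix_apply, ← Finset.sum_range_add_sum_Ico _ hrN, Finset.sum_range]
  -- The coefficients `T` act on the index `j` alone, so they reproduce every slow mode exactly,
  -- whatever its factor `exp (-(lam k * t))`.
  have hslow : ∑ k : Fin r, g i j k = ∑ l, (∑ k : Fin r, g i (J l) k) * T l j := by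
    simp only [Finset.sum_mul]
    rw [Finset.sum_comm]
    refine Finset.sum_congr rfl fun k _ => ?_
    simp only [g]
    rw [hT j k, Finset.mul_sum, Finset.mul_sum]
    exact Finset.sum_congr rfl fun l _ => by ring
  have hres : (momentMatrix rate ρ φ t - (momentMatrix rate ρ φ t).submatrix id J * T) i j =
      Q i j - ∑ l, Q i (J l) * T l j := by
    rw [Matrix.sub_apply, Matrix.mul_apply]
    simp only [Matrix.submatrix_apply, id, hsplit, add_mul, Finset.sum_add_distrib]
    rw [hslow]
    ring
  have hQ : ∀ i j, |Q i j| ≤ C₀ ^ 2 * Real.exp (-(lam r * t)) :=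
    fun i j => hB.abs_sum_fast_le hC S ht r i j
  set B := C₀ ^ 2 * Real.exp (-(lam r * t))
  have hB0 : 0 ≤ B := by positivity
  rw [hres]
  have h1 : |∑ l, Q i (J l) * T l j| ≤ r * B := by
    refine (Finset.abs_sum_le_sum_abs _ _).trans ?_
    calc _ ≤ ∑ _l : Fin r, B := Finset.sum_le_sum fun l _ => by
          rw [abs_mul]
          exact (mul_le_mul (hQ _ _) (hT1 _ _) (abs_nonneg _) hB0).trans (mul_one B).le
      _ = r * B := by simp
  calc _ ≤ |Q i j| + |∑ l, Q i (J l) * T l j| := abs_sub _ _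
    _ ≤ B + r * B := add_le_add (hQ i j) h1
    _ = _ := by ring

open scoped Matrix.Norms.Frobenius in
/-- The error of a cross approximation built from perturbed columns. -/
lemma exists_cross_approx_of_columns {N r : ℕ} (M : Matrix (ClusterIdx d n) (ClusterIdx d n) ℝ)
    (hN : N = d * n) (hM : M.transpose = M) (hr : r ≤ N ^ 2) (J : Fin r → ClusterIdx d n)
    (T : Matrix (Fin r) (ClusterIdx d n) ℝ) (hT : ∀ l i, |T l i| ≤ 1) {B : ℝ} (hB : 0 ≤ B)
    (hMT : ∀ i j, |(M - M.submatrix id J * T) i j| ≤ (1 + r) * B)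
    (C : Matrix (ClusterIdx d n) (Fin r) ℝ) {ε : ℝ} (hε : 0 ≤ ε)
    (hC : ∀ l, ‖WithLp.toLp 2 (fun i => M i (J l) - C i l)‖ ≤ ε) :
    ∃ U : Matrix (Fin r) (Fin r) ℝ, specNorm (M - C * U * C.transpose) ≤
      2 * (N ^ 2 * ((1 + √r * N) * B) + r * N * ε) := by
  obtain ⟨U, hU⟩ := exists_symmetric_cross_approx M hM C T
  refine ⟨U, hU.trans (mul_le_mul_of_nonneg_left ?_ (by norm_num))⟩
  refine (specNorm_le_frobenius _).trans ?_
  have hcard : (Fintype.card (ClusterIdx d n) : ℝ) = N ^ 2 := by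
    rw [hN]; simp [pow_two]
  have hN0 : (0 : ℝ) ≤ N := Nat.cast_nonneg _
  have h1 : ‖M - M.submatrix id J * T‖ ≤ N ^ 2 * ((1 + √r * N) * B) := by
    refine (Matrix.frobenius_norm_le_of_entry _ (by positivity) hMT).trans ?_
    rw [hcard, Real.sqrt_mul_self (by positivity)]
    refine mul_le_mul_of_nonneg_left (mul_le_mul_of_nonneg_right ?_ hB) (by positivity)
    -- Turns the `1 + r` of the entrywise bound into `1 + √r * N`.
    have h2 : √(r : ℝ) ≤ N := Real.sqrt_le_iff.2 ⟨hN0, by exact_mod_cast hr⟩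
    have h3 : (r : ℝ) = √r * √r := (Real.mul_self_sqrt (Nat.cast_nonneg r)).symm
    have h4 := mul_le_mul_of_nonneg_left h2 (Real.sqrt_nonneg (r : ℝ))
    linarith
  have h2 : ‖T‖ ≤ √r * N := by
    refine (Matrix.frobenius_norm_le_of_entry _ zero_le_one hT).trans ?_
    rw [hcard, Fintype.card_fin, Real.sqrt_mul (Nat.cast_nonneg _), Real.sqrt_sq hN0, mul_one]
  have h3 : ‖M.submatrix id J - C‖ ≤ √r * ε := by
    have := Matrix.frobenius_norm_le_of_column (M.submatrix id J - C) hε hC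
    rwa [Fintype.card_fin] at this
  have h4 : ‖(M.submatrix id J - C) * T‖ ≤ r * N * ε := by
    refine (Matrix.frobenius_norm_mul _ _).trans ?_
    calc _ ≤ (√r * ε) * (√r * N) := mul_le_mul h3 h2 (norm_nonneg _) (by positivity)
      _ = (√r * √r) * N * ε := by ring
      _ = _ := by rw [Real.mul_self_sqrt (Nat.cast_nonneg r)]
  have h5 : M - C * T = (M - M.submatrix id J * T) + (M.submatrix id J - C) * T := by
    rw [Matrix.sub_mul]; abel
  rw [h5]
  exact (norm_add_le _ _).trans (add_le_add h1 h4)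

end MomentMatrix

/-! ### The main theorem -/

theorem mainTheorem1 :
    -- the absolute constant in the sparsity bound
    ∃ K : ℕ, ∀ (X : Type*) [Fintype X] [DecidableEq X] (d n κ r : ℕ)
      (rate : Fin d → X → Config X d → ℝ) (ρ : Config X d → ℝ)
      (lam : ℕ → ℝ) (w : ℕ → Config X d → ℝ)
      (φ : Fin d → Fin n → X → ℝ) (C₀ t δ : ℝ),
      IsReversible rate ρ → 0 < κ → FiniteRange rate κ → SpectralGap rate ρ lam w →
      0 < C₀ → ClusterBound ρ φ C₀ → 0 ≤ t → 0 < δ → 1 ≤ r → r ≤ (d * n) ^ 2 →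
      ∃ (J : Fin r ↪ ClusterIdx d n) (U : Matrix (Fin r) (Fin r) ℝ)
        (C : Matrix (ClusterIdx d n) (Fin r) ℝ),
        -- each column of `C` is sparse plus rank one, and approximates a column of `M`
        (∀ l : Fin r, ∃ S W : Matrix (SiteIdx d n) (SiteIdx d n) ℝ,
          (∀ p q, C (p, q) l = S p q + W p q) ∧
          W.rank ≤ 1 ∧
          (∀ p q, InBand δ (J l) (p, q) →
            S p q = momentMatrix rate ρ φ t (p, q) (J l) - W p q) ∧
          (∀ p q, ¬ InBand δ (J l) (p, q) → S p q = 0) ∧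
          {e : SiteIdx d n × SiteIdx d n | S e.1 e.2 ≠ 0}.ncard ≤ K * (n ^ 2 * d * ⌈δ⌉₊) ∧
          ‖WithLp.toLp 2 (fun i => momentMatrix rate ρ φ t i (J l) - C i l)‖ ≤
            2 * constC₂ rate κ (lam 1) C₀ * (n * d) * Real.sqrt (d * max (d - δ) 0) *
              decayFactor rate κ (lam 1) δ) ∧
        -- the relative error bound
        (0 < sigma (r + 1) (momentMatrix rate ρ φ t) →
          (velocity rate κ + lam 1 * κ) / lam 1 *
              Real.log (2 * constC₂ rate κ (lam 1) C₀ * d ^ 2 * n ^ 2 * Real.sqrt r /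
                sigma 1 (momentMatrix rate ρ φ t)) ≤ δ →
          specNorm (momentMatrix rate ρ φ t - C * U * C.transpose) /
              specNorm (momentMatrix rate ρ φ t) ≤
            C₀ ^ 2 * (d * n) ^ 2 * (1 + 4 * Real.sqrt r * (d * n)) *
                Real.exp (-(lam r * t)) / sigma 1 (momentMatrix rate ρ φ t) +
              6 * constC₂ rate κ (lam 1) C₀ * (d * n) ^ 2 * r *
                Real.sqrt (d * max (d - δ) 0) * decayFactor rate κ (lam 1) δ /
                sigma (r + 1) (momentMatrix rate ρ φ t)) := by
  refine ⟨15, fun X _ _ d n κ r rate ρ lam w φ C₀ t δ H hκ0 hκ S hC hB ht hδ hr1 hr => ?_⟩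
  obtain ⟨J, T, hT, hMT⟩ := hB.exists_column_selection hC S ht hr
  choose c hc hcε using fun l : Fin r =>
    hB.exists_column_approx hC S H hκ0 hκ ht hδ (J l)
  set M := momentMatrix rate ρ φ t
  let C : Matrix (ClusterIdx d n) (Fin r) ℝ := Matrix.of fun i l => c l i
  set ε := 2 * constC₂ rate κ (lam 1) C₀ * (n * d) * Real.sqrt (d * max (d - δ) 0) *
    decayFactor rate κ (lam 1) δ with hε
  have hC₂ := constC₂_nonneg (C₀ := C₀) H S κ
  have hdec : 0 < decayFactor rate κ (lam 1) δ := Real.exp_pos _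
  have hε0 : 0 ≤ ε := by positivity
  have hcol : ∀ l, ∃ S W : Matrix (SiteIdx d n) (SiteIdx d n) ℝ,
      (∀ p q, C (p, q) l = S p q + W p q) ∧ W.rank ≤ 1 ∧
      (∀ p q, InBand δ (J l) (p, q) → S p q = M (p, q) (J l) - W p q) ∧
      (∀ p q, ¬ InBand δ (J l) (p, q) → S p q = 0) ∧
      {e : SiteIdx d n × SiteIdx d n | S e.1 e.2 ≠ 0}.ncard ≤ 15 * (n ^ 2 * d * ⌈δ⌉₊) ∧
      ‖WithLp.toLp 2 (fun i => M i (J l) - C i l)‖ ≤ ε := fun l => by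
    obtain ⟨S', W', h1, h2, h3, h4, h5⟩ := hc l
    exact ⟨S', W', h1, h2, h3, h4, h5, hcε l⟩
  -- When `σ_{r+1}` vanishes only the column statement has content, and any `U` serves.
  by_cases hσ : 0 < sigma (r + 1) M
  swap
  · exact ⟨J, 0, C, hcol, fun h => absurd h hσ⟩
  have hrN : r ≤ Fintype.card (Config X d) :=
    (lt_rank_of_sigma_pos M hσ).le.trans (rank_momentMatrix_le t)
  set B := C₀ ^ 2 * Real.exp (-(lam r * t)) with hBdef
  obtain ⟨U, hU⟩ := exists_cross_approx_of_columns M rfl (S.momentMatrix_transpose t) hr J T hT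
    (B := B) (by positivity) (hMT hrN) C hε0 hcε
  refine ⟨J, U, C, hcol, fun _ _ => ?_⟩
  have hσ1 : 0 < sigma 1 M := hσ.trans_le (sigma_anti M (by omega))
  have hM1 := sigma_le_specNorm M 1
  have hM2 := sigma_le_specNorm M (r + 1)
  have hr1' : 1 ≤ √(r : ℝ) := Real.one_le_sqrt.2 (by exact_mod_cast hr1)
  have hdn : (1 : ℝ) ≤ d * n := by
    have : 0 < d * n := Nat.pos_of_ne_zero fun h => by simp [h] at hr; omega
    exact_mod_cast this
  push_cast at hU
  -- `2 + 2 * s ≤ 1 + 4 * s` for `s = √r * (d * n) ≥ 1`.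
  have hA : 2 * ((d * n : ℝ) ^ 2 * ((1 + √r * (d * n)) * B)) ≤
      C₀ ^ 2 * (d * n) ^ 2 * (1 + 4 * √r * (d * n)) * Real.exp (-(lam r * t)) := by
    have h1 : 1 ≤ √(r : ℝ) * (d * n) := one_le_mul_of_one_le_of_one_le hr1' hdn
    calc _ = C₀ ^ 2 * (d * n) ^ 2 * (2 + 2 * (√r * (d * n))) * Real.exp (-(lam r * t)) := by
          rw [hBdef]; ring
      _ ≤ _ := by
          refine mul_le_mul_of_nonneg_right (mul_le_mul_of_nonneg_left ?_ (by positivity))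
            (Real.exp_pos _).le
          linarith
  have hE : 2 * (r * (d * n : ℝ) * ε) ≤ 6 * constC₂ rate κ (lam 1) C₀ * (d * n) ^ 2 * r *
      Real.sqrt (d * max (d - δ) 0) * decayFactor rate κ (lam 1) δ := by
    calc _ = 4 * (constC₂ rate κ (lam 1) C₀ * (d * n) ^ 2 * r *
          Real.sqrt (d * max (d - δ) 0) * decayFactor rate κ (lam 1) δ) := by rw [hε]; ring
      _ ≤ 6 * (constC₂ rate κ (lam 1) C₀ * (d * n) ^ 2 * r *
          Real.sqrt (d * max (d - δ) 0) * decayFactor rate κ (lam 1) δ) := by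
          gcongr
          norm_num
      _ = _ := by ring
  -- The spectral norm dominates both singular values, so each term may be divided by a different
  -- one.
  calc _ ≤ (C₀ ^ 2 * (d * n) ^ 2 * (1 + 4 * √r * (d * n)) * Real.exp (-(lam r * t)) +
        6 * constC₂ rate κ (lam 1) C₀ * (d * n) ^ 2 * r *
          Real.sqrt (d * max (d - δ) 0) * decayFactor rate κ (lam 1) δ) / specNorm M := by
        refine div_le_div_of_nonneg_right ?_ (specNorm_nonneg M)
        linarith
    _ ≤ _ := by
        rw [add_div]
        exact add_le_add (div_le_div_of_nonneg_left (by positivity) hσ1 hM1)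
          (div_le_div_of_nonneg_left (by positivity) hσ hM2)
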